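/- Let $n\ge 5$, $N\ge 2$, and let $\mathbf A=(\mathbf A_{\alpha\beta ij})$, $1\le\alpha,\beta\le N$, $1\le i,j\le n$, be a real tensor with $\mathbf A_{\alpha\beta ij}=\mathbf A_{\beta\alpha ji}$ which is rank-one positive: there is $\nu>0$ with $\sum\mathbf A_{\alpha\beta ij}\eta_\alpha a_i\eta_\beta a_j\ge\nu|\eta|^2|a|^2$ for all $\eta\in\mathbb R^N$, $a\in\mathbb R^n$. Put $\nu(\mathbf A)=\min_{|\eta|=|a|=1}\sum\mathbf A_{\alpha\beta ij}\eta_\alpha a_i\eta_\beta a_j$, $2^*=\frac{2n}{n-2}$, $2^{**}=\frac{2n}{n-4}$, $(\mathbf A:D^2u)_\alpha=\sum_{\beta,i,j}\mathbf A_{\alpha\beta ij}D^2_{ij}u_\beta$, let $\mathbf A:a\otimes a$ be the $N\times N$ matrix with entries $\sum_{i,j}\mathbf A_{\alpha\beta ij}a_ia_j$, and let $\mathrm{sgn}(x)=x/|x|$ for $x\ne0$, $\mathrm{sgn}(0)=0$. Let $$W^{2,2}_*(\mathbb R^n)^N=\{u\in L^{2^{**}}(\mathbb R^n)^N : Du\in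 L^{2^*}(\mathbb R^n)^{Nn},\ D^2u\in L^2(\mathbb R^n)^{Nn^2}\}$$ with weak derivatives, and let $\widehat g(z)=\int g(x)e^{-2\pi i x\cdot z}\,dx$, $g^\vee(x)=\int g(z)e^{2\pi i x\cdot z}\,dz$ (extended to $L^2$ by Plancherel's theorem). There is a constant $C>0$ depending only on $\mathbf A$, $n$ and $N$ such that for every real-valued $f\in L^2(\mathbb R^n)^N$ the system $\mathbf A:D^2u=f$ a.e. on $\mathbb R^n$ has a unique solution $u\in W^{2,2}_*(\mathbb R^n)^N$, and $$\|u\|_{L^{2^{**}}}+\|Du\|_{L^{2^*}}+\|D^2u\|_{L^2}\le C\|f\|_{L^2},\qquad \|D^2u\|_{L^2}\le\frac1{\nu(\mathbf A)}\|\mathbf A:D^2u\|_{L^2}.$$ Moreover, let $(h_m)$ be any sequence of even real Schwartz functions on $\mathbb R^n$ with $0\le h_m(x)\le|x|^{-2}$ and $h_m(x)\to|x|^{-2}$ as $m\to\infty$, for a.e. $x$, and set $$u_m=-\frac1{4\pi^2}\,\widehat{h_m}*\left[\frac{\mathrm{cof}(\mathbf A:\mathrm{sgn}\otimes\mathrm{sgn})^\top}{\det(\mathbf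 A:\mathrm{sgn}\otimes\mathrm{sgn})}\,f^\vee\right]^\wedge .$$ Then the bracketed function lies in $L^2$, the convolution is well defined at every point, $u_m\in L^{2^{**}}$ and $u_m\to u$ weakly in $L^{2^{**}}$; moreover every subsequence of $(u_m)$ has a further subsequence which converges to $u$ a.e. on $\mathbb R^n$. In particular the limit $u$ does not depend on the choice of $(h_m)$. -/

import Mathlib

open MeasureTheory Filter Topology
open scoped ENNReal FourierTransform SchwartzMap ContDiff

noncomputable section

namespace LinSys

/-- The exponent `2^* = 2n/(n-2)`. -/
def expStar (n : ℕ) : ℝ≥0∞ := ENNReal.ofReal (2 * (n : ℝ) / ((n : ℝ) - 2))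

/-- The exponent `2^{**} = (2^*)^* = 2n/(n-4)`. -/
def expStarStar (n : ℕ) : ℝ≥0∞ := ENNReal.ofReal (2 * (n : ℝ) / ((n : ℝ) - 4))

/-- Real fourth-order tensors, with entries `A α β i j`. -/
abbrev Tensor (N n : ℕ) : Type := Fin N → Fin N → Fin n → Fin n → ℝ

/-- Membership in `𝕊(N × n)`: `A_{αβij} = A_{βαji}`. -/
def Tensor.IsSymm {N n : ℕ} (A : Tensor N n) : Prop :=
  ∀ α β i j, A α β i j = A β α j i

/-- The quadratic form of `A` on a rank-one matrix, `A : η ⊗ a ⊗ η ⊗ a`. -/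
def Tensor.rankOneForm {N n : ℕ} (A : Tensor N n) (η : EuclideanSpace ℝ (Fin N))
    (a : EuclideanSpace ℝ (Fin n)) : ℝ :=
  ∑ α, ∑ β, ∑ i, ∑ j, A α β i j * (η α * a i) * (η β * a j)

/-- Rank-one positivity: `A : η ⊗ a ⊗ η ⊗ a ≥ ν |η|² |a|²` for some `ν > 0`. -/
def Tensor.IsRankOnePositive {N n : ℕ} (A : Tensor N n) : Prop :=
  ∃ ν : ℝ, 0 < ν ∧ ∀ (η : EuclideanSpace ℝ (Fin N)) (a : EuclideanSpace ℝ (Fin n)),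
    ν * ‖η‖ ^ 2 * ‖a‖ ^ 2 ≤ A.rankOneForm η a

/-- The ellipticity constant `ν(A) = min_{|η| = |a| = 1} A : η ⊗ a ⊗ η ⊗ a`. -/
def Tensor.ellipticityConst {N n : ℕ} (A : Tensor N n) : ℝ :=
  sInf {r : ℝ | ∃ (η : EuclideanSpace ℝ (Fin N)) (a : EuclideanSpace ℝ (Fin n)),
    ‖η‖ = 1 ∧ ‖a‖ = 1 ∧ r = A.rankOneForm η a}

/-- The contraction `A : Z`, with components `∑ A_{αβij} Z_{βij}`. -/
def Tensor.contract {N n : ℕ} (A : Tensor N n)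
    (Z : EuclideanSpace ℝ (Fin N × Fin n × Fin n)) : EuclideanSpace ℝ (Fin N) :=
  WithLp.toLp 2 fun α => ∑ β, ∑ i, ∑ j, A α β i j * Z (β, i, j)

/-- The `N × N` matrix `A : a ⊗ a`, with entries `∑ A_{αβij} a_i a_j`. -/
def Tensor.acoustic {N n : ℕ} (A : Tensor N n) (a : EuclideanSpace ℝ (Fin n)) :
    Matrix (Fin N) (Fin N) ℝ :=
  Matrix.of fun α β => ∑ i, ∑ j, A α β i j * a i * a j

/-- The sign function on `ℝⁿ`: `x / |x|` for `x ≠ 0`, and `0` at the origin. -/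
def sgn {n : ℕ} (x : EuclideanSpace ℝ (Fin n)) : EuclideanSpace ℝ (Fin n) :=
  ‖x‖⁻¹ • x

/-- The cofactor matrix. -/
def cof {N : ℕ} (X : Matrix (Fin N) (Fin N) ℝ) : Matrix (Fin N) (Fin N) ℝ :=
  X.adjugate.transpose

/-- The symbol `cof (A : sgn z ⊗ sgn z)ᵀ / det (A : sgn z ⊗ sgn z)`. -/
def Tensor.symbol {N n : ℕ} (A : Tensor N n) (z : EuclideanSpace ℝ (Fin n)) :
    Matrix (Fin N) (Fin N) ℝ :=
  ((A.acoustic (sgn z)).det)⁻¹ • (cof (A.acoustic (sgn z))).transpose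

/-- `w` is the weak partial derivative `D_i v` of the scalar function `v` on `ℝⁿ`. -/
structure HasWeakPartial {n : ℕ} (i : Fin n) (v w : EuclideanSpace ℝ (Fin n) → ℝ) : Prop where
  locallyIntegrable : LocallyIntegrable v volume
  locallyIntegrable_deriv : LocallyIntegrable w volume
  integral_eq : ∀ φ : EuclideanSpace ℝ (Fin n) → ℝ, ContDiff ℝ ∞ φ → HasCompactSupport φ →
    ∫ x, v x * fderiv ℝ φ x (EuclideanSpace.single i 1) = -∫ x, w x * φ x

/-- `u ∈ W^{2,2}_*(ℝⁿ)^N` with weak gradient `Du` and weak hessian `D2u`: `u ∈ L^{2**}`,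
`Du ∈ L^{2*}` and `D²u ∈ L²`, all with respect to the euclidean norms. -/
structure IsW22Star {N n : ℕ}
    (u : EuclideanSpace ℝ (Fin n) → EuclideanSpace ℝ (Fin N))
    (Du : EuclideanSpace ℝ (Fin n) → EuclideanSpace ℝ (Fin N × Fin n))
    (D2u : EuclideanSpace ℝ (Fin n) → EuclideanSpace ℝ (Fin N × Fin n × Fin n)) : Prop where
  memLp : MemLp u (expStarStar n) volume
  memLp_grad : MemLp Du (expStar n) volume
  memLp_hess : MemLp D2u 2 volume
  weak_grad : ∀ α i, HasWeakPartial i (fun x => u x α) (fun x => Du x (α, i))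
  weak_hess : ∀ α i j, HasWeakPartial i (fun x => Du x (α, j)) (fun x => D2u x (α, i, j))

/-- Componentwise inclusion `ℝ^N ⊆ ℂ^N`. -/
def toComplex {N : ℕ} (v : EuclideanSpace ℝ (Fin N)) : EuclideanSpace ℂ (Fin N) :=
  WithLp.toLp 2 fun α => (v α : ℂ)

open Classical in
/-- The `L²` (Plancherel) Fourier transform of a function in `L²`, extended by `0` to functions
that are not in `L²`. -/
def fourierL2 {N n : ℕ} (g : EuclideanSpace ℝ (Fin n) → EuclideanSpace ℂ (Fin N)) :
    EuclideanSpace ℝ (Fin n) → EuclideanSpace ℂ (Fin N) :=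
  if hg : MemLp g 2 volume then
    ((𝓕 (hg.toLp g) : Lp (α := EuclideanSpace ℝ (Fin n)) (EuclideanSpace ℂ (Fin N)) 2 volume) :
      EuclideanSpace ℝ (Fin n) → EuclideanSpace ℂ (Fin N))
  else 0

open Classical in
/-- The inverse `L²` Fourier transform of a function in `L²`, extended by `0` to functions that
are not in `L²`. -/
def fourierInvL2 {N n : ℕ} (g : EuclideanSpace ℝ (Fin n) → EuclideanSpace ℂ (Fin N)) :
    EuclideanSpace ℝ (Fin n) → EuclideanSpace ℂ (Fin N) :=
  if hg : MemLp g 2 volume then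
    ((𝓕⁻ (hg.toLp g) : Lp (α := EuclideanSpace ℝ (Fin n)) (EuclideanSpace ℂ (Fin N)) 2 volume) :
      EuclideanSpace ℝ (Fin n) → EuclideanSpace ℂ (Fin N))
  else 0

/-- The function `cof (A : sgn ⊗ sgn)ᵀ / det (A : sgn ⊗ sgn)` applied to the inverse Fourier
transform of `f`. -/
def Tensor.multiplied {N n : ℕ} (A : Tensor N n)
    (f : EuclideanSpace ℝ (Fin n) → EuclideanSpace ℝ (Fin N)) :
    EuclideanSpace ℝ (Fin n) → EuclideanSpace ℂ (Fin N) :=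
  fun z => WithLp.toLp 2
    (((A.symbol z).map (algebraMap ℝ ℂ)).mulVec
      (fun α => fourierInvL2 (fun x => toComplex (f x)) z α))

/-- The Fourier transform of a real-valued Schwartz function, by its integral formula. -/
def fourierSchwartz {n : ℕ} (h : 𝓢(EuclideanSpace ℝ (Fin n), ℝ)) :
    EuclideanSpace ℝ (Fin n) → ℂ :=
  𝓕 (fun x => (h x : ℂ))

/-- The regularised solution
`-1/(4π²) · ĥ ∗ [cof (A : sgn ⊗ sgn)ᵀ / det (A : sgn ⊗ sgn) f^∨]^∧`. -/
def Tensor.approx {N n : ℕ} (A : Tensor N n)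
    (f : EuclideanSpace ℝ (Fin n) → EuclideanSpace ℝ (Fin N))
    (h : 𝓢(EuclideanSpace ℝ (Fin n), ℝ)) :
    EuclideanSpace ℝ (Fin n) → EuclideanSpace ℂ (Fin N) :=
  fun x => (-(1 / (4 * (Real.pi : ℂ) ^ 2))) •
    convolution (fourierSchwartz h) (fourierL2 (A.multiplied f))
      (ContinuousLinearMap.lsmul ℂ ℂ) volume x

/-- Even Schwartz functions `h_m` with `0 ≤ h_m ≤ 1/|x|²` and `h_m → 1/|x|²` almost everywhere. -/
structure IsRegularisation {n : ℕ} (h : ℕ → 𝓢(EuclideanSpace ℝ (Fin n), ℝ)) : Prop where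
  even : ∀ m x, h m (-x) = h m x
  bounds : ∀ m, ∀ᵐ x ∂(volume : Measure (EuclideanSpace ℝ (Fin n))),
    0 ≤ h m x ∧ h m x ≤ 1 / ‖x‖ ^ 2
  tendsto : ∀ᵐ x ∂(volume : Measure (EuclideanSpace ℝ (Fin n))),
    Tendsto (fun m => h m x) atTop (𝓝 (1 / ‖x‖ ^ 2))

/-- Weak convergence in `L^p(ℝⁿ; ℂ^N)`, tested against the conjugate Lebesgue space. -/
structure WeakLpTendsto {N n : ℕ} (p : ℝ≥0∞)
    (v : ℕ → EuclideanSpace ℝ (Fin n) → EuclideanSpace ℂ (Fin N))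
    (w : EuclideanSpace ℝ (Fin n) → EuclideanSpace ℂ (Fin N)) : Prop where
  memLp : ∀ m, MemLp (v m) p volume
  memLp_lim : MemLp w p volume
  tendsto : ∀ q : ℝ≥0∞, p.HolderConjugate q →
    ∀ g : EuclideanSpace ℝ (Fin n) → EuclideanSpace ℂ (Fin N), MemLp g q volume →
      Tendsto (fun m => ∫ x, inner ℂ (g x) (v m x)) atTop (𝓝 (∫ x, inner ℂ (g x) (w x)))

end LinSys

end

/-!
The system is solved first for right-hand sides `f = A : D²Φ` with `Φ` a Schwartz function, where
everything is explicit on the Fourier side, and then for all `f ∈ L²` by density.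

*A priori estimates.* The inverse Fourier transform turns `A : D²Φ` into `-4π² (A : z ⊗ z) Φ^∨`.
Rank-one positivity gives `|(A : z ⊗ z) v| ≥ ν(A) |z|² |v|`, so Plancherel's theorem yields
`‖D²Φ‖_{L²} ≤ ν(A)⁻¹ ‖A : D²Φ‖_{L²}` with the sharp constant (`eLpNorm_hess_le`). Two applications
of the Gagliardo–Nirenberg–Sobolev inequality, which extends from compactly supported to Schwartz
functions by cutoffs, bound `DΦ` in `L^{2^*}` and `Φ` in `L^{2^{**}}` (`exists_apriori`).

*Existence.* If a function in `L²` is orthogonal to all `A : D²Φ`, its inverse Fourier transform is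
at almost every `z` orthogonal to the range of the matrix `A : z ⊗ z`, which is invertible for
`z ≠ 0`; so it vanishes, and the functions `A : D²Φ` are dense in `L²` (`exists_seq_op_tendsto`).
If `A : D²Φ_k → f`, the a priori estimates make `Φ_k`, `DΦ_k`, `D²Φ_k` Cauchy sequences, and weak
derivatives pass to the limit (`exists_solution`).

*Uniqueness.* Let `H` be the weak hessian of a solution `w` of the homogeneous system. Moving both
weak derivatives to the test function, commuting partial derivatives and using the symmetry of `A`,
one finds that each `H_{·kl}` is orthogonal to all `A : D²Φ`, hence zero. A function in `L^p`,
`p < ∞`, with a vanishing weak partial derivative is zero, so `Dw = 0` and then `w = 0`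
(`solution_unique`).

*Representation formula.* Since `cof(A : sgn ⊗ sgn)ᵀ / det(A : sgn ⊗ sgn)` is `|z|²` times the
inverse of `A : z ⊗ z` for `z ≠ 0`, the regularised solution for `f = A : D²Φ` is the
Fourier transform of `h_m |z|² Φ^∨` (`exists_approx_op_eq`). As `0 ≤ h_m |z|² ≤ 1` and
`h_m |z|² → 1`, the Sobolev inequality in the form `‖𝓕 ψ‖_{L^{2^{**}}} ≤ C ‖|z|² ψ‖_{L²}` gives a
bound by `C ‖f‖_{L²}` independent of `m`, and dominated convergence gives convergence to `Φ` in `L^{2^{**}}`. Convolution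
with a fixed `L²` function is continuous from `L²` to bounded functions, so by Fatou's lemma the
bound passes to all `f ∈ L²`, and with it the convergence (`tendsto_eLpNorm_approx_sub`). The
convergence in `L^{2^{**}}` is thus strong, which contains the weak convergence and the almost
everywhere convergence of subsequences.
-/

noncomputable section

namespace LinSys

open scoped LineDeriv NNReal

/-! ### The Sobolev inequality for Schwartz functions -/

/-- Smooth cutoffs `β (x / (k + 1))`: eventually `1` near every point, with gradients of size
`O(1 / (k + 1))`. -/
lemma exists_cutoff (E : Type*) [NormedAddCommGroup E] [InnerProductSpace ℝ E]
    [FiniteDimensional ℝ E] :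
    ∃ (χ : ℕ → E → ℝ) (M : ℝ), 0 ≤ M ∧ (∀ k, ContDiff ℝ ∞ (χ k)) ∧
      (∀ k, HasCompactSupport (χ k)) ∧ (∀ k x, ‖χ k x‖ ≤ 1) ∧
      (∀ x, Tendsto (fun k => χ k x) atTop (𝓝 1)) ∧
      (∀ k x, ‖fderiv ℝ (χ k) x‖ ≤ M / (k + 1)) := by
  let β : ContDiffBump (0 : E) := ⟨1, 2, one_pos, one_lt_two⟩
  have hβ : ContDiff ℝ ∞ (β : E → ℝ) := β.contDiff
  have hc : HasCompactSupport (β : E → ℝ) := β.hasCompactSupport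
  obtain ⟨M, hM⟩ := (hβ.continuous_fderiv (by simp)).bounded_above_of_compact_support (hc.fderiv ℝ)
  have hpos : ∀ k : ℕ, (0 : ℝ) < (k + 1 : ℝ)⁻¹ := fun k => by positivity
  refine ⟨fun k x => β ((k + 1 : ℝ)⁻¹ • x), M, (norm_nonneg _).trans (hM 0), fun k => ?_,
    fun k => ?_, fun k x => ?_, fun x => ?_, fun k x => ?_⟩
  · exact hβ.comp (contDiff_const_smul _)
  · exact hc.comp_smul (hpos k).ne'
  · rw [Real.norm_of_nonneg β.nonneg]
    exact β.le_one
  · refine tendsto_const_nhds.congr' ?_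
    have h0 : Tendsto (fun k : ℕ => ((k : ℝ) + 1)⁻¹ • x) atTop (𝓝 ((0 : ℝ) • x)) :=
      (tendsto_one_div_add_atTop_nhds_zero_nat.congr fun k => by simp).smul_const x
    rw [zero_smul] at h0
    filter_upwards [h0.eventually (Metric.closedBall_mem_nhds 0 one_pos)] with k hk
    exact (β.one_of_mem_closedBall hk).symm
  · have h : HasFDerivAt (fun x : E => β ((k + 1 : ℝ)⁻¹ • x))
        ((fderiv ℝ β ((k + 1 : ℝ)⁻¹ • x)).comp ((k + 1 : ℝ)⁻¹ • ContinuousLinearMap.id ℝ E)) x :=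
      ((hβ.differentiable (by simp)) _).hasFDerivAt.comp x ((hasFDerivAt_id x).const_smul _)
    rw [h.fderiv, ContinuousLinearMap.comp_smul, ContinuousLinearMap.comp_id, norm_smul,
      Real.norm_of_nonneg (hpos k).le, div_eq_inv_mul]
    exact mul_le_mul_of_nonneg_left (hM _) (hpos k).le

lemma eLpNorm_fderiv_cutoff_le {E F : Type*} [NormedAddCommGroup E] [InnerProductSpace ℝ E]
    [FiniteDimensional ℝ E] [MeasurableSpace E] [BorelSpace E] [NormedAddCommGroup F]
    [NormedSpace ℝ F] {μ : Measure E} {p : ℝ≥0∞} (hp : 1 ≤ p) {χ : E → ℝ} {φ : E → F} {m : ℝ}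
    (hχ : ContDiff ℝ 1 χ) (hφ : ContDiff ℝ 1 φ) (hm : 0 ≤ m) (hle : ∀ x, ‖χ x‖ ≤ 1)
    (hd : ∀ x, ‖fderiv ℝ χ x‖ ≤ m) :
    eLpNorm (fderiv ℝ (fun x => χ x • φ x)) p μ ≤
      eLpNorm (fderiv ℝ φ) p μ + ENNReal.ofReal m * eLpNorm φ p μ := by
  have h1 : ∀ x, ‖fderiv ℝ (fun x => χ x • φ x) x‖ ≤ ‖(‖fderiv ℝ φ x‖ + m * ‖φ x‖ : ℝ)‖ := by
    intro x
    rw [fderiv_fun_smul (hχ.differentiable (by simp) x) (hφ.differentiable (by simp) x),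
      Real.norm_of_nonneg (by positivity)]
    refine (norm_add_le _ _).trans (add_le_add ?_ ?_)
    · rw [norm_smul]
      exact mul_le_of_le_one_left (norm_nonneg _) (hle x)
    · rw [ContinuousLinearMap.norm_smulRight_apply]
      exact mul_le_mul_of_nonneg_right (hd x) (norm_nonneg _)
  have h2 : eLpNorm (fun x => m * ‖φ x‖) p μ ≤ ENNReal.ofReal m * eLpNorm φ p μ := by
    refine (eLpNorm_const_smul_le (c := m) (f := fun x => ‖φ x‖)).trans ?_
    rw [eLpNorm_norm, Real.enorm_eq_ofReal hm]
  refine (eLpNorm_mono h1).trans ((eLpNorm_add_le (f := fun x => ‖fderiv ℝ φ x‖)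
    (g := fun x => m * ‖φ x‖) ?_ ?_ hp).trans ?_)
  · exact (hφ.continuous_fderiv (by simp)).norm.aestronglyMeasurable
  · exact (continuous_const.mul hφ.continuous.norm).aestronglyMeasurable
  · rw [eLpNorm_norm]
    exact add_le_add le_rfl h2

lemma tendsto_const_mul_add_ofReal_div {C a b : ℝ≥0∞} (hC : C ≠ ⊤) (hb : b ≠ ⊤) (M : ℝ) :
    Tendsto (fun k : ℕ => C * (a + ENNReal.ofReal (M / (k + 1)) * b)) atTop (𝓝 (C * a)) := by
  have h0 : Tendsto (fun k : ℕ => M / ((k : ℝ) + 1)) atTop (𝓝 0) := by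
    simpa [div_eq_mul_inv] using tendsto_one_div_add_atTop_nhds_zero_nat.const_mul M
  have h1 := ENNReal.Tendsto.const_mul (tendsto_const_nhds (x := a).add
    (ENNReal.Tendsto.mul_const (ENNReal.tendsto_ofReal h0) (Or.inr hb))) (Or.inr hC)
  simpa using h1

/-- The Gagliardo-Nirenberg-Sobolev inequality, for Schwartz functions in place of compactly
supported ones. -/
lemma eLpNorm_le_eLpNorm_fderiv {n : ℕ} (hn : 0 < n) {F : Type*} [NormedAddCommGroup F]
    [InnerProductSpace ℝ F] {p p' : ℝ≥0} (hp : 1 ≤ p)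
    (hp' : (p' : ℝ)⁻¹ = (p : ℝ)⁻¹ - (n : ℝ)⁻¹) (φ : 𝓢(EuclideanSpace ℝ (Fin n), F)) :
    eLpNorm φ p' volume ≤
      eLpNormLESNormFDerivOfEqInnerConst (volume : Measure (EuclideanSpace ℝ (Fin n))) p *
        eLpNorm (fderiv ℝ φ) p volume := by
  generalize hC : eLpNormLESNormFDerivOfEqInnerConst
    (volume : Measure (EuclideanSpace ℝ (Fin n))) p = C
  obtain ⟨χ, M, hM, hsm, hcs, hle, hlim, hd⟩ := exists_cutoff (EuclideanSpace ℝ (Fin n))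
  have hφ : ContDiff ℝ 1 φ := φ.smooth 1
  have hχ : ∀ k, ContDiff ℝ 1 (χ k) := fun k => (hsm k).of_le (by simp)
  have hs : ∀ k, ContDiff ℝ 1 (fun x => χ k x • φ x) := fun k => (hχ k).smul hφ
  have key : ∀ k : ℕ, eLpNorm (fun x => χ k x • φ x) p' volume ≤
      C * (eLpNorm (fderiv ℝ φ) p volume + ENNReal.ofReal (M / (k + 1)) * eLpNorm φ p volume) := by
    intro k
    have h0 := eLpNorm_le_eLpNorm_fderiv_of_eq_inner
      (volume : Measure (EuclideanSpace ℝ (Fin n))) (hs k)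
      ((hcs k).smul_right) hp (by simpa using hn) (by simpa using hp')
    rw [hC] at h0
    exact h0.trans (mul_le_mul_right (eLpNorm_fderiv_cutoff_le (by exact_mod_cast hp) (hχ k) hφ
      (by positivity) (hle k) (hd k)) _)
  have hpt : ∀ x, Tendsto (fun k => χ k x • φ x) atTop (𝓝 (φ x)) := fun x => by
    simpa only [one_smul] using (hlim x).smul_const (φ x)
  have hfin : eLpNorm φ p volume ≠ ⊤ := (φ.eLpNorm_lt_top (p : ℝ≥0∞) volume).ne
  have hlim2 := tendsto_const_mul_add_ofReal_div (a := eLpNorm (fderiv ℝ φ) p volume)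
    (ENNReal.coe_ne_top (r := C)) hfin M
  refine (Lp.eLpNorm_lim_le_liminf_eLpNorm (f := fun k x => χ k x • φ x)
    (fun k => (hs k).continuous.aestronglyMeasurable) φ
    (ae_of_all _ hpt)).trans ?_
  rw [← hlim2.liminf_eq]
  exact liminf_le_liminf (Eventually.of_forall key)

/-- The `i`-th vector of the standard basis of `ℝⁿ`. -/
abbrev basisVec {n : ℕ} (i : Fin n) : EuclideanSpace ℝ (Fin n) := EuclideanSpace.single i 1

/-- The `i`-th partial derivative of a Schwartz function. -/
abbrev pd {n : ℕ} {F : Type*} [NormedAddCommGroup F] [NormedSpace ℝ F] (i : Fin n)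
    (φ : 𝓢(EuclideanSpace ℝ (Fin n), F)) : 𝓢(EuclideanSpace ℝ (Fin n), F) :=
  ∂_{basisVec i} φ

lemma norm_clm_le_sum {n : ℕ} {F : Type*} [NormedAddCommGroup F] [NormedSpace ℝ F]
    (T : EuclideanSpace ℝ (Fin n) →L[ℝ] F) : ‖T‖ ≤ ∑ i, ‖T (basisVec i)‖ := by
  refine T.opNorm_le_bound (Finset.sum_nonneg fun _ _ => norm_nonneg _) fun v => ?_
  have hv : v = ∑ i, v i • basisVec i := by
    ext j
    simp [Finset.sum_apply, Pi.single_apply]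
  conv_lhs => rw [hv, map_sum]
  rw [Finset.sum_mul]
  refine norm_sum_le_of_le _ fun i _ => ?_
  rw [map_smul, norm_smul, mul_comm]
  exact mul_le_mul_of_nonneg_left (PiLp.norm_apply_le v i) (norm_nonneg _)

lemma eLpNorm_le_sum_lineDeriv {n : ℕ} (hn : 0 < n) {F : Type*} [NormedAddCommGroup F]
    [InnerProductSpace ℝ F] {p p' : ℝ≥0} (hp : 1 ≤ p)
    (hp' : (p' : ℝ)⁻¹ = (p : ℝ)⁻¹ - (n : ℝ)⁻¹) (φ : 𝓢(EuclideanSpace ℝ (Fin n), F)) :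
    eLpNorm φ p' volume ≤
      eLpNormLESNormFDerivOfEqInnerConst (volume : Measure (EuclideanSpace ℝ (Fin n))) p *
        ∑ i : Fin n, eLpNorm (pd i φ) p volume := by
  refine (eLpNorm_le_eLpNorm_fderiv hn hp hp' φ).trans ?_
  gcongr
  have h1 : ∀ x, ‖fderiv ℝ φ x‖ ≤ ‖(∑ i : Fin n, fun x => ‖(pd i φ) x‖) x‖ := by
    intro x
    rw [Finset.sum_apply, Real.norm_of_nonneg (Finset.sum_nonneg fun _ _ => norm_nonneg _)]
    exact norm_clm_le_sum _
  refine (eLpNorm_mono h1).trans ((eLpNorm_sum_le (fun i _ => ?_) (by exact_mod_cast hp)).trans ?_)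
  · exact (SchwartzMap.continuous _).norm.aestronglyMeasurable
  · simp [eLpNorm_norm]

lemma five_le_cast {n : ℕ} (hn : 5 ≤ n) : (5 : ℝ) ≤ n := by exact_mod_cast hn

lemma one_le_expStar {n : ℕ} (hn : 5 ≤ n) : 1 ≤ expStar n := by
  have := five_le_cast hn
  rw [expStar, ← ENNReal.ofReal_one]
  apply ENNReal.ofReal_le_ofReal
  rw [le_div_iff₀ (by linarith)]
  linarith

lemma one_le_expStarStar {n : ℕ} (hn : 5 ≤ n) : 1 ≤ expStarStar n := by
  have := five_le_cast hn
  rw [expStarStar, ← ENNReal.ofReal_one]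
  apply ENNReal.ofReal_le_ofReal
  rw [le_div_iff₀ (by linarith)]
  linarith

/-- `W^{1,2} ⊆ L^{2*}` for Schwartz functions. -/
lemma exists_sobolev_expStar {n : ℕ} (hn : 5 ≤ n) : ∃ C : ℝ≥0, ∀ {F : Type} [NormedAddCommGroup F]
    [InnerProductSpace ℝ F] (φ : 𝓢(EuclideanSpace ℝ (Fin n), F)),
    eLpNorm φ (expStar n) volume ≤ C * ∑ i : Fin n, eLpNorm (pd i φ) 2 volume := by
  have := five_le_cast hn
  refine ⟨_, fun φ => eLpNorm_le_sum_lineDeriv (p := 2)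
    (p' := (2 * (n : ℝ) / ((n : ℝ) - 2)).toNNReal) (by omega) (by norm_num) ?_ φ⟩
  rw [Real.coe_toNNReal _ (div_nonneg (by linarith) (by linarith))]
  have : (n : ℝ) - 2 ≠ 0 := by linarith
  have : (n : ℝ) ≠ 0 := by linarith
  push_cast
  field_simp

/-- `W^{2,2} ⊆ L^{2**}` for Schwartz functions, by two applications of the Sobolev inequality. -/
lemma exists_sobolev_expStarStar {n : ℕ} (hn : 5 ≤ n) :
    ∃ C : ℝ≥0, ∀ {F : Type} [NormedAddCommGroup F] [InnerProductSpace ℝ F]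
      (φ : 𝓢(EuclideanSpace ℝ (Fin n), F)), eLpNorm φ (expStarStar n) volume ≤
      C * ∑ j : Fin n, ∑ i : Fin n, eLpNorm (pd i (pd j φ)) 2 volume := by
  have h5 := five_le_cast hn
  obtain ⟨C₁, h₁⟩ := exists_sobolev_expStar hn
  have hp : 1 ≤ (2 * (n : ℝ) / ((n : ℝ) - 2)).toNNReal := by
    have := one_le_expStar hn
    rw [expStar, ENNReal.ofReal] at this
    exact_mod_cast this
  have hp' : ((2 * (n : ℝ) / ((n : ℝ) - 4)).toNNReal : ℝ)⁻¹ =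
      ((2 * (n : ℝ) / ((n : ℝ) - 2)).toNNReal : ℝ)⁻¹ - (n : ℝ)⁻¹ := by
    rw [Real.coe_toNNReal _ (div_nonneg (by linarith) (by linarith)),
      Real.coe_toNNReal _ (div_nonneg (by linarith) (by linarith))]
    have : (n : ℝ) - 2 ≠ 0 := by linarith
    have : (n : ℝ) - 4 ≠ 0 := by linarith
    have : (n : ℝ) ≠ 0 := by linarith
    field_simp
    ring
  refine ⟨eLpNormLESNormFDerivOfEqInnerConst (volume : Measure (EuclideanSpace ℝ (Fin n)))
    (2 * (n : ℝ) / ((n : ℝ) - 2)).toNNReal * C₁, fun φ => ?_⟩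
  refine (eLpNorm_le_sum_lineDeriv (by omega) hp hp' φ).trans ?_
  rw [ENNReal.coe_mul, mul_assoc, Finset.mul_sum (a := (C₁ : ℝ≥0∞))]
  exact mul_le_mul_right (Finset.sum_le_sum fun j _ => h₁ (pd j φ)) _

/-! ### Limits in Lebesgue spaces -/

section Limits

variable {X : Type*} [MeasurableSpace X] {μ : Measure X} {F G H : Type*} [NormedAddCommGroup F]
  [NormedAddCommGroup G] [NormedAddCommGroup H]

lemma tendsto_integral_of_tendsto_eLpNorm [NormedSpace ℝ H] {p q : ℝ≥0∞} (hpq : p.HolderConjugate q)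
    {a : ℕ → X → F} {b : X → F} {g : X → G} (ha : ∀ k, MemLp (a k) p μ) (hb : MemLp b p μ)
    (hg : MemLp g q μ) (hlim : Tendsto (fun k => eLpNorm (a k - b) p μ) atTop (𝓝 0))
    (B : F → G → H)
    (hBm : ∀ c : X → F, MemLp c p μ → AEStronglyMeasurable (fun x => B (c x) (g x)) μ)
    (hB : ∀ v w, ‖B v w‖ ≤ ‖v‖ * ‖w‖) (hBsub : ∀ v v' w, B (v - v') w = B v w - B v' w) :
    Tendsto (fun k => ∫ x, B (a k x) (g x) ∂μ) atTop (𝓝 (∫ x, B (b x) (g x) ∂μ)) := by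
  have hn : ∀ c : X → F, MemLp c p μ →
      eLpNorm (fun x => B (c x) (g x)) 1 μ ≤ eLpNorm c p μ * eLpNorm g q μ := by
    intro c hc
    have h := eLpNorm_le_eLpNorm_mul_eLpNorm_of_nnnorm (p := p) (q := q) (r := 1) hc.1 hg.1 B 1
      (ae_of_all _ fun x => by simpa using! hB (c x) (g x))
    simpa using h
  have hint : ∀ c : X → F, MemLp c p μ → Integrable (fun x => B (c x) (g x)) μ := fun c hc =>
    memLp_one_iff_integrable.1 ⟨hBm c hc, (hn c hc).trans_lt (ENNReal.mul_lt_top hc.2 hg.2)⟩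
  refine tendsto_integral_of_L1' _ (hint b hb).1 (Eventually.of_forall fun k => hint _ (ha k)) ?_
  have h0 : Tendsto (fun k => eLpNorm (a k - b) p μ * eLpNorm g q μ) atTop (𝓝 0) := by
    simpa using ENNReal.Tendsto.mul_const hlim (Or.inr hg.2.ne)
  refine tendsto_of_tendsto_of_tendsto_of_le_of_le tendsto_const_nhds h0 (fun _ => zero_le)
    fun k => ?_
  have h1 : ((fun x => B (a k x) (g x)) - fun x => B (b x) (g x)) =
      fun x => B ((a k - b) x) (g x) := by
    ext x
    simp [hBsub]
  rw [h1]
  exact hn _ ((ha k).sub hb)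

lemma tendsto_eLpNorm_of_tendsto_eLpNorm_sub {p : ℝ≥0∞} (hp : 1 ≤ p) {a : ℕ → X → F} {b : X → F}
    (ha : ∀ k, MemLp (a k) p μ) (hb : MemLp b p μ)
    (hlim : Tendsto (fun k => eLpNorm (a k - b) p μ) atTop (𝓝 0)) :
    Tendsto (fun k => eLpNorm (a k) p μ) atTop (𝓝 (eLpNorm b p μ)) := by
  have : Fact (1 ≤ p) := ⟨hp⟩
  have h := ((Lp.tendsto_Lp_iff_tendsto_eLpNorm'' a ha b hb).2 hlim).norm
  have h2 := ENNReal.tendsto_ofReal h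
  simpa only [Lp.norm_toLp, ENNReal.ofReal_toReal (ha _).2.ne, ENNReal.ofReal_toReal hb.2.ne]
    using h2

/-- If the increments of `a` in `L^p` are controlled by those of a convergent sequence in `L^q`,
then `a` converges in `L^p`. -/
lemma exists_lim_of_eLpNorm_sub_le [CompleteSpace F] {p q : ℝ≥0∞} (hp : 1 ≤ p) (hq : 1 ≤ q)
    {a : ℕ → X → F} {b : ℕ → X → G} {b' : X → G} (ha : ∀ k, MemLp (a k) p μ)
    (hb : ∀ k, MemLp (b k) q μ) (hb' : MemLp b' q μ)
    (hlim : Tendsto (fun k => eLpNorm (b k - b') q μ) atTop (𝓝 0)) (C : ℝ≥0)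
    (hle : ∀ k l, eLpNorm (a k - a l) p μ ≤ C * eLpNorm (b k - b l) q μ) :
    ∃ a' : X → F, MemLp a' p μ ∧ Tendsto (fun k => eLpNorm (a k - a') p μ) atTop (𝓝 0) := by
  have : Fact (1 ≤ p) := ⟨hp⟩
  have : Fact (1 ≤ q) := ⟨hq⟩
  have h1 := ((Lp.tendsto_Lp_iff_tendsto_eLpNorm'' b hb b' hb').2 hlim).cauchySeq
  have h2 : CauchySeq fun k => (ha k).toLp (a k) := by
    rw [EMetric.cauchySeq_iff] at h1 ⊢
    intro ε hε
    obtain ⟨K, hK⟩ := h1 (ε / (C + 1)) (ENNReal.div_pos hε.ne' (by finiteness))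
    refine ⟨K, fun k hk l hl => ?_⟩
    have h3 := hK k hk l hl
    rw [Lp.edist_toLp_toLp] at h3 ⊢
    calc _ ≤ C * eLpNorm (b k - b l) q μ := hle k l
      _ ≤ (C + 1) * eLpNorm (b k - b l) q μ := by gcongr; exact le_self_add
      _ < ε := by
        rw [mul_comm]
        exact (ENNReal.lt_div_iff_mul_lt (Or.inl (by simp)) (Or.inl (by finiteness))).1 h3
  obtain ⟨a', ha'⟩ := cauchySeq_tendsto_of_complete h2
  refine ⟨a', Lp.memLp a', ?_⟩
  rw [← Lp.toLp_coeFn a' (Lp.memLp a')] at ha'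
  exact (Lp.tendsto_Lp_iff_tendsto_eLpNorm'' a ha a' (Lp.memLp a')).1 ha'

end Limits

/-! ### Weak derivatives -/

section Weak

variable {n : ℕ}

lemma integrable_mul_schwartz {v : EuclideanSpace ℝ (Fin n) → ℝ} {p : ℝ≥0∞} (hp : 1 ≤ p)
    (hv : MemLp v p volume) (φ : 𝓢(EuclideanSpace ℝ (Fin n), ℝ)) :
    Integrable (fun x => v x * φ x) := by
  have := ENNReal.HolderConjugate.conjExponent hp
  exact MemLp.integrable_mul hv (φ.memLp p.conjExponent volume)

/-- Schwartz functions are admissible test functions in the definition of weak derivatives of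
functions in Lebesgue spaces. -/
lemma HasWeakPartial.integral_schwartz {i : Fin n} {v w : EuclideanSpace ℝ (Fin n) → ℝ}
    (h : HasWeakPartial i v w) {p q : ℝ≥0∞} (hp : 1 ≤ p) (hq : 1 ≤ q) (hv : MemLp v p volume)
    (hw : MemLp w q volume) (φ : 𝓢(EuclideanSpace ℝ (Fin n), ℝ)) :
    ∫ x, v x * pd i φ x = -∫ x, w x * φ x := by
  obtain ⟨χ, M, hM, hsm, hcs, hle, hlim, hd⟩ := exists_cutoff (EuclideanSpace ℝ (Fin n))
  have hφ : ContDiff ℝ ∞ φ := φ.smooth _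
  have hfd : ∀ k x, fderiv ℝ (fun x => χ k x * φ x) x (basisVec i) =
      χ k x * pd i φ x + φ x * fderiv ℝ (χ k) x (basisVec i) := fun k x => by
    rw [fderiv_fun_mul ((hsm k).differentiable (by simp) x) (hφ.differentiable (by simp) x)]
    simp [SchwartzMap.lineDerivOp_apply_eq_fderiv]
  have hdi : ∀ k x, ‖fderiv ℝ (χ k) x (basisVec i)‖ ≤ M / (k + 1) := fun k x =>
    ((fderiv ℝ (χ k) x).le_opNorm _).trans (by simpa using hd k x)
  have hdlim : ∀ x, Tendsto (fun k => fderiv ℝ (χ k) x (basisVec i)) atTop (𝓝 0) := fun x =>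
    squeeze_zero_norm (fun k => hdi k x)
      (by simpa [div_eq_mul_inv] using tendsto_one_div_add_atTop_nhds_zero_nat.const_mul M)
  have key : ∀ k, ∫ x, v x * fderiv ℝ (fun x => χ k x * φ x) x (basisVec i) =
      -∫ x, w x * (χ k x * φ x) := fun k =>
    h.integral_eq _ ((hsm k).mul hφ) ((hcs k).mul_right)
  have hL : Tendsto (fun k => ∫ x, v x * fderiv ℝ (fun x => χ k x * φ x) x (basisVec i)) atTop
      (𝓝 (∫ x, v x * pd i φ x)) := by
    refine tendsto_integral_of_dominated_convergence
      (fun x => ‖v x * pd i φ x‖ + M * ‖v x * φ x‖) (fun k => ?_)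
      ((integrable_mul_schwartz hp hv (pd i φ)).norm.add
        ((integrable_mul_schwartz hp hv φ).norm.const_mul M)) (fun k => ae_of_all _ fun x => ?_)
      (ae_of_all _ fun x => ?_)
    · exact hv.1.mul ((((hsm k).mul hφ).continuous_fderiv (by simp)).clm_apply
        continuous_const).aestronglyMeasurable
    · rw [hfd, mul_add]
      refine (norm_add_le _ _).trans (add_le_add ?_ ?_)
      · rw [mul_left_comm, norm_mul]
        exact mul_le_of_le_one_left (norm_nonneg _) (hle k x)
      · rw [← mul_assoc, norm_mul, mul_comm]
        refine mul_le_mul_of_nonneg_right ((hdi k x).trans ?_) (norm_nonneg _)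
        exact div_le_self hM (by simp)
    · simp only [hfd]
      simpa using (((hlim x).mul_const (pd i φ x)).add ((hdlim x).const_mul (φ x))).const_mul (v x)
  have hR : Tendsto (fun k => -∫ x, w x * (χ k x * φ x)) atTop (𝓝 (-∫ x, w x * φ x)) := by
    refine (tendsto_integral_of_dominated_convergence (fun x => ‖w x * φ x‖) (fun k => ?_)
      (integrable_mul_schwartz hq hw φ).norm (fun k => ae_of_all _ fun x => ?_)
      (ae_of_all _ fun x => ?_)).neg
    · exact hw.1.mul ((hsm k).continuous.mul hφ.continuous).aestronglyMeasurable
    · rw [mul_left_comm, norm_mul]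
      exact mul_le_of_le_one_left (norm_nonneg _) (hle k x)
    · simpa using ((hlim x).mul_const (φ x)).const_mul (w x)
  exact tendsto_nhds_unique hL (by simpa only [key] using hR)

lemma hasWeakPartial_schwartz (i : Fin n) (φ : 𝓢(EuclideanSpace ℝ (Fin n), ℝ)) :
    HasWeakPartial i φ (pd i φ) where
  locallyIntegrable := φ.continuous.locallyIntegrable
  locallyIntegrable_deriv := (pd i φ).continuous.locallyIntegrable
  integral_eq ψ hψ hc := by
    have h := SchwartzMap.integral_mul_lineDerivOp_right_eq_neg_left (μ := volume) φ
      (hc.toSchwartzMap hψ) (basisVec i)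
    simpa [SchwartzMap.lineDerivOp_apply_eq_fderiv] using! h

/-- Weak derivatives are preserved by convergence in Lebesgue spaces. -/
lemma HasWeakPartial.of_tendsto {i : Fin n} {a b : ℕ → EuclideanSpace ℝ (Fin n) → ℝ}
    {a' b' : EuclideanSpace ℝ (Fin n) → ℝ} (h : ∀ k, HasWeakPartial i (a k) (b k)) {p q : ℝ≥0∞}
    (hp : 1 ≤ p) (hq : 1 ≤ q) (ha : ∀ k, MemLp (a k) p volume) (hb : ∀ k, MemLp (b k) q volume)
    (ha' : MemLp a' p volume) (hb' : MemLp b' q volume)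
    (hla : Tendsto (fun k => eLpNorm (a k - a') p volume) atTop (𝓝 0))
    (hlb : Tendsto (fun k => eLpNorm (b k - b') q volume) atTop (𝓝 0)) :
    HasWeakPartial i a' b' where
  locallyIntegrable := ha'.locallyIntegrable hp
  locallyIntegrable_deriv := hb'.locallyIntegrable hq
  integral_eq ψ hψ hc := by
    have hp' := ENNReal.HolderConjugate.conjExponent hp
    have hq' := ENNReal.HolderConjugate.conjExponent hq
    have hψ' : Continuous fun x => fderiv ℝ ψ x (basisVec i) :=
      (hψ.continuous_fderiv (by simp)).clm_apply continuous_const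
    have h1 := tendsto_integral_of_tendsto_eLpNorm hp' ha ha'
      (hψ'.memLp_of_hasCompactSupport (hc.fderiv_apply ℝ _)) hla (fun x y => x * y)
      (fun c hc => hc.1.mul hψ'.aestronglyMeasurable) (fun v w => (norm_mul v w).le)
      (fun v v' w => sub_mul v v' w)
    have h2 := tendsto_integral_of_tendsto_eLpNorm hq' hb hb'
      (hψ.continuous.memLp_of_hasCompactSupport hc) hlb (fun x y => x * y)
      (fun c hc => hc.1.mul hψ.continuous.aestronglyMeasurable) (fun v w => (norm_mul v w).le)
      (fun v v' w => sub_mul v v' w)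
    exact tendsto_nhds_unique h1 (by simpa only [(h _).integral_eq ψ hψ hc] using h2.neg)

lemma HasWeakPartial.sub {i : Fin n} {v w v' w' : EuclideanSpace ℝ (Fin n) → ℝ}
    (h : HasWeakPartial i v w) (h' : HasWeakPartial i v' w') :
    HasWeakPartial i (fun x => v x - v' x) (fun x => w x - w' x) where
  locallyIntegrable := h.locallyIntegrable.sub h'.locallyIntegrable
  locallyIntegrable_deriv := h.locallyIntegrable_deriv.sub h'.locallyIntegrable_deriv
  integral_eq ψ hψ hc := by
    have hψ' : Continuous fun x => fderiv ℝ ψ x (basisVec i) :=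
      (hψ.continuous_fderiv (by simp)).clm_apply continuous_const
    have hi : ∀ u : EuclideanSpace ℝ (Fin n) → ℝ, LocallyIntegrable u →
        ∀ g : EuclideanSpace ℝ (Fin n) → ℝ, Continuous g → HasCompactSupport g →
          Integrable fun x => u x * g x := fun u hu g hg hgc => by
      simpa [mul_comm] using! hu.integrable_smul_left_of_hasCompactSupport hg hgc
    simp only [sub_mul]
    rw [integral_sub (hi _ h.locallyIntegrable _ hψ' (hc.fderiv_apply ℝ _))
        (hi _ h'.locallyIntegrable _ hψ' (hc.fderiv_apply ℝ _)),
      integral_sub (hi _ h.locallyIntegrable_deriv _ hψ.continuous hc)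
        (hi _ h'.locallyIntegrable_deriv _ hψ.continuous hc), h.integral_eq ψ hψ hc,
      h'.integral_eq ψ hψ hc]
    ring

/-- The convolution of a function in `L^p`, `p < ∞`, with a test function tends to zero along every
line. -/
lemma tendsto_convolution_zero {v ψ : EuclideanSpace ℝ (Fin n) → ℝ} {p : ℝ≥0∞} (hp : 1 ≤ p)
    (hp' : p ≠ ⊤) (hv : MemLp v p volume) (hψ : Continuous ψ) (hc : HasCompactSupport ψ)
    {e : EuclideanSpace ℝ (Fin n)} (he : e ≠ 0) :
    Tendsto (fun s : ℝ => ∫ x, v x * ψ (s • e - x)) atTop (𝓝 0) := by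
  have := ENNReal.HolderConjugate.conjExponent hp
  have hψq : MemLp ψ p.conjExponent volume := hψ.memLp_of_hasCompactSupport hc
  have hψs : ∀ s : ℝ, MemLp (fun x => ψ (s • e - x)) p.conjExponent volume := fun s =>
    hψq.comp_measurePreserving (Measure.measurePreserving_sub_left volume (s • e))
  have hψn : ∀ s : ℝ, eLpNorm (fun x => ψ (s • e - x)) p.conjExponent volume =
      eLpNorm ψ p.conjExponent volume := fun s =>
    eLpNorm_comp_measurePreserving hψq.1 (Measure.measurePreserving_sub_left volume (s • e))
  rw [tendsto_zero_iff_enorm_tendsto_zero, ENNReal.tendsto_nhds_zero]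
  intro ε hε
  obtain ⟨g, hgc, hgε, hg, hgp⟩ := hv.exists_hasCompactSupport_eLpNorm_sub_le hp'
    (ε := ε / (eLpNorm ψ p.conjExponent volume + 1))
    (ENNReal.div_pos hε.ne' (by simp [hψq.2.ne])).ne'
  obtain ⟨R, hR⟩ := hgc.isCompact.isBounded.subset_closedBall (0 : EuclideanSpace ℝ (Fin n))
  obtain ⟨R', hR'⟩ := hc.isCompact.isBounded.subset_closedBall (0 : EuclideanSpace ℝ (Fin n))
  filter_upwards [eventually_gt_atTop ((R + R') / ‖e‖), eventually_ge_atTop 0] with s hs hs0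
  have hzero : ∀ x, g x * ψ (s • e - x) = 0 := by
    intro x
    by_contra hx
    have h1 : ‖x‖ ≤ R := by
      simpa using hR (subset_tsupport _ (left_ne_zero_of_mul hx))
    have h2 : ‖s • e - x‖ ≤ R' := by
      simpa using hR' (subset_tsupport _ (right_ne_zero_of_mul hx))
    have h3 : s * ‖e‖ ≤ R + R' := by
      calc s * ‖e‖ = ‖x + (s • e - x)‖ := by
            rw [add_sub_cancel, norm_smul, Real.norm_of_nonneg hs0]
        _ ≤ R + R' := (norm_add_le _ _).trans (add_le_add h1 h2)
    exact absurd h3 (not_le.2 ((div_lt_iff₀ (norm_pos_iff.2 he)).1 hs))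
  have heq : ∀ x, v x * ψ (s • e - x) = (v - g) x * ψ (s • e - x) := fun x => by
    rw [Pi.sub_apply, sub_mul, hzero, sub_zero]
  simp only [heq]
  calc ‖∫ x, (v - g) x * ψ (s • e - x)‖ₑ
      ≤ ∫⁻ x, ‖(v - g) x * ψ (s • e - x)‖ₑ := enorm_integral_le_lintegral_enorm _
    _ = eLpNorm (fun x => (v - g) x * ψ (s • e - x)) 1 volume :=
        eLpNorm_one_eq_lintegral_enorm.symm
    _ ≤ eLpNorm (v - g) p volume * eLpNorm (fun x => ψ (s • e - x)) p.conjExponent volume := by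
        have := eLpNorm_le_eLpNorm_mul_eLpNorm_of_nnnorm (p := p) (q := p.conjExponent) (r := 1)
          (hv.1.sub hgp.1) (hψs s).1 (fun x y => x * y) 1 (ae_of_all _ fun x => by simp)
        simpa using this
    _ ≤ ε / (eLpNorm ψ p.conjExponent volume + 1) * (eLpNorm ψ p.conjExponent volume + 1) := by
        rw [hψn]
        gcongr
        exact le_self_add
    _ ≤ ε := (ENNReal.div_mul_cancel (by simp) (by simp [hψq.2.ne])).le

/-- A function in `L^p`, `p < ∞`, one of whose weak partial derivatives vanishes is zero: its
mollifications are constant along lines and vanish at infinity. -/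
lemma HasWeakPartial.ae_eq_zero {i : Fin n} {v w : EuclideanSpace ℝ (Fin n) → ℝ}
    (h : HasWeakPartial i v w) {p : ℝ≥0∞} (hp : 1 ≤ p) (hp' : p ≠ ⊤) (hv : MemLp v p volume)
    (hw : w =ᵐ[volume] 0) : v =ᵐ[volume] 0 := by
  refine ae_eq_zero_of_integral_contDiff_smul_eq_zero h.locallyIntegrable fun g hg hgc => ?_
  set ψ : EuclideanSpace ℝ (Fin n) → ℝ := fun x => g (-x) with hψ_def
  have hψ : ContDiff ℝ ∞ ψ := hg.comp contDiff_neg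
  have hψc : HasCompactSupport ψ := hgc.comp_homeomorph (Homeomorph.neg _)
  set G : ℝ → ℝ := fun s => ∫ x, v x * ψ (s • basisVec i - x) with hG
  have hder : ∀ s, HasDerivAt G 0 s := by
    intro s
    have h1 := hψc.hasFDerivAt_convolution_right (ContinuousLinearMap.mul ℝ ℝ) (μ := volume)
      h.locallyIntegrable (hψ.of_le (by simp)) (s • basisVec i)
    have h2 : HasDerivAt (fun s : ℝ => s • (basisVec i : EuclideanSpace ℝ (Fin n)))
        ((1 : ℝ) • basisVec i) s := (hasDerivAt_id s).smul_const _
    have h3 := h1.comp_hasDerivAt s h2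
    rw [one_smul, convolution_precompR_apply _ h.locallyIntegrable (hψc.fderiv ℝ)
      (hψ.continuous_fderiv (by simp))] at h3
    have h4 : convolution v (fun a => fderiv ℝ ψ a (basisVec i)) (ContinuousLinearMap.mul ℝ ℝ)
        volume (s • basisVec i) = 0 := by
      have hs : ContDiff ℝ ∞ fun x => ψ (s • basisVec i - x) :=
        hψ.comp (contDiff_const.sub contDiff_id)
      have h5 := h.integral_eq (fun x => ψ (s • basisVec i - x)) hs
        (hψc.comp_homeomorph (Homeomorph.subLeft _))
      have h6 : ∀ x, fderiv ℝ (fun x => ψ (s • basisVec i - x)) x (basisVec i) =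
          -(fderiv ℝ ψ (s • basisVec i - x) (basisVec i)) := fun x => by
        have h7 := (hψ.differentiable (by simp) (s • basisVec i - x)).hasFDerivAt.comp x
          ((hasFDerivAt_id x).const_sub (s • basisVec i))
        refine (congrArg (fun T : EuclideanSpace ℝ (Fin n) →L[ℝ] ℝ => T (basisVec i))
          h7.fderiv).trans ?_
        simp
      have h9 : ∫ x, w x * ψ (s • basisVec i - x) = 0 := by
        rw [integral_eq_zero_of_ae]
        filter_upwards [hw] with x hx
        simp [hx]
      simp only [h6, mul_neg, integral_neg, h9, neg_zero] at h5
      rw [convolution_def]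
      simpa using h5
    rw [h4] at h3
    exact h3
  have hconst : ∀ s, G s = G 0 := fun s =>
    is_const_of_deriv_eq_zero (fun s => (hder s).differentiableAt) (fun s => (hder s).deriv) s 0
  have hlim : Tendsto G atTop (𝓝 0) := tendsto_convolution_zero hp hp' hv hψ.continuous hψc
    (by simp [basisVec])
  have h0 : G 0 = 0 := tendsto_nhds_unique (tendsto_const_nhds.congr fun s => (hconst s).symm) hlim
  simpa [hG, hψ_def, mul_comm] using h0

end Weak

/-! ### Ellipticity of the symbol -/

section Algebra

variable {N n : ℕ} (A : Tensor N n)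

lemma rankOneForm_eq_acoustic (η : EuclideanSpace ℝ (Fin N)) (a : EuclideanSpace ℝ (Fin n)) :
    A.rankOneForm η a = ∑ α, ∑ β, A.acoustic a α β * (η α * η β) := by
  simp only [Tensor.rankOneForm, Tensor.acoustic, Matrix.of_apply, Finset.sum_mul]
  refine Finset.sum_congr rfl fun α _ => Finset.sum_congr rfl fun β _ =>
    Finset.sum_congr rfl fun i _ => Finset.sum_congr rfl fun j _ => ?_
  ring

lemma acoustic_smul (c : ℝ) (a : EuclideanSpace ℝ (Fin n)) :
    A.acoustic (c • a) = c ^ 2 • A.acoustic a := by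
  ext α β
  simp only [Tensor.acoustic, Matrix.of_apply, Matrix.smul_apply, PiLp.smul_apply, smul_eq_mul,
    Finset.mul_sum]
  refine Finset.sum_congr rfl fun i _ => Finset.sum_congr rfl fun j _ => ?_
  ring

lemma rankOneForm_smul (c d : ℝ) (η : EuclideanSpace ℝ (Fin N)) (a : EuclideanSpace ℝ (Fin n)) :
    A.rankOneForm (c • η) (d • a) = c ^ 2 * d ^ 2 * A.rankOneForm η a := by
  simp only [rankOneForm_eq_acoustic, acoustic_smul, Matrix.smul_apply, PiLp.smul_apply,
    smul_eq_mul, Finset.mul_sum]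
  refine Finset.sum_congr rfl fun i _ => Finset.sum_congr rfl fun j _ => ?_
  ring

variable {A}

lemma ellipticityConst_pos (hn : 0 < n) (hN : 0 < N) (hA : A.IsRankOnePositive) :
    0 < A.ellipticityConst := by
  obtain ⟨ν, hν, h⟩ := hA
  refine hν.trans_le (le_csInf ?_ ?_)
  · exact ⟨_, EuclideanSpace.single ⟨0, hN⟩ 1, EuclideanSpace.single ⟨0, hn⟩ 1, by simp, by simp,
      rfl⟩
  · rintro r ⟨η, a, hη, ha, rfl⟩
    simpa [hη, ha] using h η a

lemma ellipticityConst_mul_le (hA : A.IsRankOnePositive) (η : EuclideanSpace ℝ (Fin N))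
    (a : EuclideanSpace ℝ (Fin n)) :
    A.ellipticityConst * ‖η‖ ^ 2 * ‖a‖ ^ 2 ≤ A.rankOneForm η a := by
  obtain ⟨ν, hν, h⟩ := hA
  by_cases hη : η = 0
  · have := rankOneForm_smul A 0 1 η a
    simp [hη] at this ⊢
    exact this.ge
  by_cases ha : a = 0
  · have := rankOneForm_smul A 1 0 η a
    simp [ha] at this ⊢
    exact this.ge
  have hη' := norm_pos_iff.2 hη
  have ha' := norm_pos_iff.2 ha
  have h1 : A.ellipticityConst ≤ A.rankOneForm (‖η‖⁻¹ • η) (‖a‖⁻¹ • a) := by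
    refine csInf_le ⟨0, ?_⟩ ⟨_, _, ?_, ?_, rfl⟩
    · rintro r ⟨η, a, hη, ha, rfl⟩
      refine le_trans ?_ (h η a)
      positivity
    · rw [norm_smul, norm_inv, norm_norm, inv_mul_cancel₀ hη'.ne']
    · rw [norm_smul, norm_inv, norm_norm, inv_mul_cancel₀ ha'.ne']
  rw [rankOneForm_smul] at h1
  calc A.ellipticityConst * ‖η‖ ^ 2 * ‖a‖ ^ 2
      ≤ (‖η‖⁻¹ ^ 2 * ‖a‖⁻¹ ^ 2 * A.rankOneForm η a) * ‖η‖ ^ 2 * ‖a‖ ^ 2 := by gcongr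
    _ = A.rankOneForm η a := by field_simp

/-- A real matrix, acting on `𝕜^N`. -/
def matAction (𝕜 : Type*) [RCLike 𝕜] (M : Matrix (Fin N) (Fin N) ℝ) :
    EuclideanSpace 𝕜 (Fin N) →L[𝕜] EuclideanSpace 𝕜 (Fin N) :=
  Matrix.toEuclideanCLM (𝕜 := 𝕜) (M.map (algebraMap ℝ 𝕜))

lemma matAction_apply {𝕜 : Type*} [RCLike 𝕜] (M : Matrix (Fin N) (Fin N) ℝ)
    (v : EuclideanSpace 𝕜 (Fin N)) (α : Fin N) :
    matAction 𝕜 M v α = ∑ β, (M α β : 𝕜) * v β := by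
  simp [matAction, Matrix.mulVec, dotProduct]

lemma matAction_mul (M M' : Matrix (Fin N) (Fin N) ℝ) (v : EuclideanSpace ℂ (Fin N)) :
    matAction ℂ (M * M') v = matAction ℂ M (matAction ℂ M' v) := by
  rw [matAction, Matrix.map_mul, map_mul]
  rfl

lemma matAction_smul (c : ℝ) (M : Matrix (Fin N) (Fin N) ℝ) (v : EuclideanSpace ℂ (Fin N)) :
    matAction ℂ (c • M) v = (c : ℂ) • matAction ℂ M v := by
  ext α
  simp [matAction_apply, Finset.mul_sum, mul_assoc]

lemma matAction_one (v : EuclideanSpace ℂ (Fin N)) : matAction ℂ 1 v = v := by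
  simp [matAction]

lemma matAction_acoustic (A : Tensor N n) (z : EuclideanSpace ℝ (Fin n))
    (v : EuclideanSpace ℂ (Fin N)) : matAction ℂ (A.acoustic z) v =
      ∑ i, ∑ j, (z i * z j) • matAction ℂ (Matrix.of fun α β => A α β i j) v := by
  ext α
  simp only [WithLp.ofLp_sum, Finset.sum_apply, PiLp.smul_apply, matAction_apply, Matrix.of_apply,
    Tensor.acoustic, Complex.real_smul, Finset.mul_sum, RCLike.ofReal_sum, Finset.sum_mul]
  rw [Finset.sum_comm]
  refine Finset.sum_congr rfl fun i _ => ?_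
  rw [Finset.sum_comm]
  refine Finset.sum_congr rfl fun j _ => Finset.sum_congr rfl fun β _ => ?_
  simp
  ring

/-- The real quadratic form of `A : a ⊗ a` splits into those of the real and imaginary parts, so the
ellipticity bound holds on `ℂ^N`; the Cauchy-Schwarz inequality turns it into a lower bound. -/
lemma le_norm_matAction_acoustic (hA : A.IsRankOnePositive) (a : EuclideanSpace ℝ (Fin n))
    (v : EuclideanSpace ℂ (Fin N)) :
    A.ellipticityConst * ‖a‖ ^ 2 * ‖v‖ ≤ ‖matAction ℂ (A.acoustic a) v‖ := by
  by_cases hv : v = 0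
  · simp [hv]
  set x : EuclideanSpace ℝ (Fin N) := WithLp.toLp 2 fun α => (v α).re with hx
  set y : EuclideanSpace ℝ (Fin N) := WithLp.toLp 2 fun α => (v α).im with hy
  have h1 : ‖v‖ ^ 2 = ‖x‖ ^ 2 + ‖y‖ ^ 2 := by
    simp only [EuclideanSpace.norm_sq_eq, ← Finset.sum_add_distrib, Complex.sq_norm,
      Complex.normSq_apply, Real.norm_eq_abs, sq_abs, hx, hy]
    exact Finset.sum_congr rfl fun α _ => by ring
  have h2 : (inner ℂ v (matAction ℂ (A.acoustic a) v)).re =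
      A.rankOneForm x a + A.rankOneForm y a := by
    simp only [PiLp.inner_apply, matAction_apply, rankOneForm_eq_acoustic,
      ← Finset.sum_add_distrib, Complex.re_sum, RCLike.inner_apply, Finset.sum_mul, hx, hy]
    refine Finset.sum_congr rfl fun α _ => Finset.sum_congr rfl fun β _ => ?_
    simp
    ring
  have h3 : A.ellipticityConst * ‖a‖ ^ 2 * ‖v‖ * ‖v‖ ≤
      ‖matAction ℂ (A.acoustic a) v‖ * ‖v‖ := by
    calc A.ellipticityConst * ‖a‖ ^ 2 * ‖v‖ * ‖v‖
        = A.ellipticityConst * ‖x‖ ^ 2 * ‖a‖ ^ 2 + A.ellipticityConst * ‖y‖ ^ 2 * ‖a‖ ^ 2 := by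
          linear_combination A.ellipticityConst * ‖a‖ ^ 2 * h1
      _ ≤ (inner ℂ v (matAction ℂ (A.acoustic a) v)).re := by
          rw [h2]
          exact add_le_add (ellipticityConst_mul_le hA x a) (ellipticityConst_mul_le hA y a)
      _ ≤ ‖v‖ * ‖matAction ℂ (A.acoustic a) v‖ := by
          simpa using re_inner_le_norm (𝕜 := ℂ) v (matAction ℂ (A.acoustic a) v)
      _ = _ := mul_comm _ _
  exact le_of_mul_le_mul_right h3 (norm_pos_iff.2 hv)

lemma det_acoustic_ne_zero (hpos : 0 < A.ellipticityConst) (hA : A.IsRankOnePositive)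
    {a : EuclideanSpace ℝ (Fin n)} (ha : a ≠ 0) : (A.acoustic a).det ≠ 0 := by
  intro h0
  obtain ⟨v, hv, hv0⟩ := Matrix.exists_mulVec_eq_zero_iff.2 h0
  have h1 := ellipticityConst_mul_le hA (WithLp.toLp 2 v) a
  have h2 : A.rankOneForm (WithLp.toLp 2 v) a = 0 := by
    rw [rankOneForm_eq_acoustic]
    refine Finset.sum_eq_zero fun α _ => ?_
    have := congrFun hv0 α
    simp only [Matrix.mulVec, dotProduct, Pi.zero_apply] at this
    calc ∑ β, A.acoustic a α β * (v α * v β) = v α * ∑ β, A.acoustic a α β * v β := by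
          rw [Finset.mul_sum]
          exact Finset.sum_congr rfl fun β _ => by ring
      _ = 0 := by rw [this, mul_zero]
  rw [h2] at h1
  have h3 : 0 < ‖(WithLp.toLp 2 v : EuclideanSpace ℝ (Fin N))‖ := norm_pos_iff.2 (by simpa using hv)
  have h4 := norm_pos_iff.2 ha
  exact absurd h1 (not_le.2 (by positivity))

lemma matAction_symbol_zero (v : EuclideanSpace ℂ (Fin N)) :
    matAction ℂ (A.symbol (0 : EuclideanSpace ℝ (Fin n))) v = 0 := by
  rcases isEmpty_or_nonempty (Fin N) with h | h
  · exact Subsingleton.elim _ _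
  · have : A.acoustic (sgn (0 : EuclideanSpace ℝ (Fin n))) = 0 := by
      ext
      simp [Tensor.acoustic, sgn]
    rw [Tensor.symbol, this, Matrix.det_zero, inv_zero, zero_smul]
    ext α
    simp [matAction_apply]

lemma symbol_mul_acoustic_sgn (hpos : 0 < A.ellipticityConst) (hA : A.IsRankOnePositive)
    {z : EuclideanSpace ℝ (Fin n)} (hz : z ≠ 0) :
    A.symbol z * A.acoustic (sgn z) = 1 ∧ A.acoustic (sgn z) * A.symbol z = 1 := by
  have h0 : (A.acoustic (sgn z)).det ≠ 0 := det_acoustic_ne_zero hpos hA (by simp [sgn, hz])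
  constructor
  · rw [Tensor.symbol, cof, Matrix.transpose_transpose, Matrix.smul_mul, Matrix.adjugate_mul,
      smul_smul, inv_mul_cancel₀ h0, one_smul]
  · rw [Tensor.symbol, cof, Matrix.transpose_transpose, Matrix.mul_smul, Matrix.mul_adjugate,
      smul_smul, inv_mul_cancel₀ h0, one_smul]

lemma symbol_mul_acoustic (hpos : 0 < A.ellipticityConst) (hA : A.IsRankOnePositive)
    (z : EuclideanSpace ℝ (Fin n)) : A.symbol z * A.acoustic z = ‖z‖ ^ 2 • 1 := by
  by_cases hz : z = 0
  · have : A.acoustic (0 : EuclideanSpace ℝ (Fin n)) = 0 := by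
      ext
      simp [Tensor.acoustic]
    simp [hz, this]
  · have h1 : A.acoustic z = ‖z‖ ^ 2 • A.acoustic (sgn z) := by
      rw [sgn, acoustic_smul, smul_smul, inv_pow,
        mul_inv_cancel₀ (pow_ne_zero _ (norm_ne_zero_iff.2 hz)), one_smul]
    rw [h1, Matrix.mul_smul, (symbol_mul_acoustic_sgn hpos hA hz).1]

lemma norm_matAction_symbol_le (hpos : 0 < A.ellipticityConst) (hA : A.IsRankOnePositive)
    (z : EuclideanSpace ℝ (Fin n)) (v : EuclideanSpace ℂ (Fin N)) :
    ‖matAction ℂ (A.symbol z) v‖ ≤ (A.ellipticityConst)⁻¹ * ‖v‖ := by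
  by_cases hz : z = 0
  · subst hz
    rw [matAction_symbol_zero, norm_zero]
    positivity
  · have h1 := le_norm_matAction_acoustic hA (sgn z) (matAction ℂ (A.symbol z) v)
    rw [← matAction_mul, (symbol_mul_acoustic_sgn hpos hA hz).2, matAction_one, sgn,
      norm_smul, norm_inv, norm_norm, inv_mul_cancel₀ (norm_ne_zero_iff.2 hz), one_pow,
      mul_one] at h1
    rwa [le_inv_mul_iff₀ hpos]

lemma measurable_symbol (A : Tensor N n) (α β : Fin N) : Measurable fun z => A.symbol z α β := by
  have h1 : Measurable (sgn (n := n)) := measurable_norm.inv.smul measurable_id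
  have h2 : Continuous A.acoustic := by
    refine continuous_matrix fun α β => ?_
    simp only [Tensor.acoustic, Matrix.of_apply]
    fun_prop
  have h3 : Measurable fun z : EuclideanSpace ℝ (Fin n) => (A.acoustic (sgn z)).det :=
    (h2.matrix_det.measurable).comp h1
  have h4 : Measurable fun z : EuclideanSpace ℝ (Fin n) => (A.acoustic (sgn z)).adjugate α β :=
    ((h2.matrix_adjugate.matrix_elem α β).measurable).comp h1
  have h5 : (fun z => A.symbol z α β) =
      fun z => ((A.acoustic (sgn z)).det)⁻¹ * (A.acoustic (sgn z)).adjugate α β := by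
    ext z
    simp [Tensor.symbol, cof]
  rw [h5]
  exact h3.inv.mul h4

end Algebra

/-! ### Second order operators on Schwartz functions -/

section Operators

variable {n : ℕ} {𝕜 : Type*} [RCLike 𝕜] {V W : Type*} [NormedAddCommGroup V] [NormedSpace ℝ V]
  [NormedSpace 𝕜 V] [NormedAddCommGroup W] [NormedSpace ℝ W] [NormedSpace 𝕜 W]

lemma pd_postcompCLM (T : V →L[ℝ] W) (i : Fin n) (φ : 𝓢(EuclideanSpace ℝ (Fin n), V)) :
    pd i (φ.postcompCLM T) = (pd i φ).postcompCLM T := by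
  ext x
  rw [SchwartzMap.postcompCLM_apply, SchwartzMap.lineDerivOp_apply_eq_fderiv,
    SchwartzMap.lineDerivOp_apply_eq_fderiv]
  have h := T.hasFDerivAt.comp x (φ.hasFDerivAt x)
  exact congrArg (fun S : EuclideanSpace ℝ (Fin n) →L[ℝ] W => S (basisVec i)) h.fderiv

/-- Partial derivatives of Schwartz functions commute. -/
lemma pd_comm (i j : Fin n) (φ : 𝓢(EuclideanSpace ℝ (Fin n), V)) :
    pd i (pd j φ) = pd j (pd i φ) := by
  ext x
  have h : ∀ i j : Fin n, pd i (pd j φ) x = fderiv ℝ (fderiv ℝ φ) x (basisVec i) (basisVec j) := by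
    intro i j
    rw [SchwartzMap.lineDerivOp_apply_eq_fderiv]
    have h1 : (pd j φ : EuclideanSpace ℝ (Fin n) → V) = fun y => fderiv ℝ φ y (basisVec j) :=
      funext fun y => SchwartzMap.lineDerivOp_apply_eq_fderiv _ _ _
    have h2 : DifferentiableAt ℝ (fderiv ℝ φ) x :=
      ((φ.smooth 2).fderiv_right (m := 1) (by norm_num)).differentiable (by simp) x
    rw [h1, fderiv_clm_apply h2 (differentiableAt_const _)]
    simp
  rw [h i j, h j i]
  exact (φ.smooth 2).contDiffAt.isSymmSndFDerivAt (by simp) _ _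

lemma pd_sub (i : Fin n) (φ ψ : 𝓢(EuclideanSpace ℝ (Fin n), V)) :
    pd i (φ - ψ) = pd i φ - pd i ψ :=
  map_sub (LineDeriv.lineDerivOpCLM ℝ 𝓢(EuclideanSpace ℝ (Fin n), V) (basisVec i)) φ ψ

/-- The constant coefficient operator `∑ T_{ij} ∂_i ∂_j`. -/
def secondOrder (T : Fin n → Fin n → V →L[𝕜] W) (φ : 𝓢(EuclideanSpace ℝ (Fin n), V)) :
    𝓢(EuclideanSpace ℝ (Fin n), W) :=
  ∑ i, ∑ j, (pd i (pd j φ)).postcompCLM (T i j)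

lemma secondOrder_apply (T : Fin n → Fin n → V →L[𝕜] W) (φ : 𝓢(EuclideanSpace ℝ (Fin n), V))
    (x : EuclideanSpace ℝ (Fin n)) : secondOrder T φ x = ∑ i, ∑ j, T i j (pd i (pd j φ) x) := by
  simp [secondOrder]

lemma secondOrder_sub (T : Fin n → Fin n → V →L[𝕜] W) (φ ψ : 𝓢(EuclideanSpace ℝ (Fin n), V)) :
    secondOrder T (φ - ψ) = secondOrder T φ - secondOrder T ψ := by
  simp only [secondOrder, pd_sub, map_sub, Finset.sum_sub_distrib]

end Operators

section Hessian

variable {N n : ℕ} (𝕜 : Type*) [RCLike 𝕜]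

/-- The inclusion of `𝕜^N` into `𝕜^{N × n × n}` as the vectors supported at the indices
`(·, i, j)`. -/
def hessIncl (i j : Fin n) :
    EuclideanSpace 𝕜 (Fin N) →L[𝕜] EuclideanSpace 𝕜 (Fin N × Fin n × Fin n) :=
  LinearMap.toContinuousLinearMap
    { toFun := fun v => WithLp.toLp 2 fun p => if p.2 = (i, j) then v p.1 else 0
      map_add' := fun v w => by
        ext p
        by_cases h : p.2 = (i, j) <;> simp [h]
      map_smul' := fun c v => by
        ext p
        by_cases h : p.2 = (i, j) <;> simp [h] }

/-- The inclusion of `𝕜^N` into `𝕜^{N × n}` as the vectors supported at the indices `(·, i)`. -/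
def gradIncl (i : Fin n) : EuclideanSpace 𝕜 (Fin N) →L[𝕜] EuclideanSpace 𝕜 (Fin N × Fin n) :=
  LinearMap.toContinuousLinearMap
    { toFun := fun v => WithLp.toLp 2 fun p => if p.2 = i then v p.1 else 0
      map_add' := fun v w => by
        ext p
        by_cases h : p.2 = i <;> simp [h]
      map_smul' := fun c v => by
        ext p
        by_cases h : p.2 = i <;> simp [h] }

variable {𝕜}

lemma hessIncl_apply (i j : Fin n) (v : EuclideanSpace 𝕜 (Fin N)) (p : Fin N × Fin n × Fin n) :
    hessIncl 𝕜 i j v p = if p.2 = (i, j) then v p.1 else 0 := rfl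

lemma gradIncl_apply (i : Fin n) (v : EuclideanSpace 𝕜 (Fin N)) (p : Fin N × Fin n) :
    gradIncl 𝕜 i v p = if p.2 = i then v p.1 else 0 := rfl

/-- The gradient of a vector-valued Schwartz function, with entries `∂_i Φ_α`. -/
def grad (Φ : 𝓢(EuclideanSpace ℝ (Fin n), EuclideanSpace 𝕜 (Fin N))) :
    𝓢(EuclideanSpace ℝ (Fin n), EuclideanSpace 𝕜 (Fin N × Fin n)) :=
  ∑ i, (pd i Φ).postcompCLM (gradIncl 𝕜 i)

/-- The hessian of a vector-valued Schwartz function, with entries `∂_i ∂_j Φ_α`. -/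
def hess (Φ : 𝓢(EuclideanSpace ℝ (Fin n), EuclideanSpace 𝕜 (Fin N))) :
    𝓢(EuclideanSpace ℝ (Fin n), EuclideanSpace 𝕜 (Fin N × Fin n × Fin n)) :=
  secondOrder (hessIncl 𝕜) Φ

/-- The operator `Φ ↦ A : D²Φ` on Schwartz functions. -/
def Tensor.op (A : Tensor N n) (Φ : 𝓢(EuclideanSpace ℝ (Fin n), EuclideanSpace 𝕜 (Fin N))) :
    𝓢(EuclideanSpace ℝ (Fin n), EuclideanSpace 𝕜 (Fin N)) :=
  secondOrder (fun i j => matAction 𝕜 (Matrix.of fun α β => A α β i j)) Φ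

variable (Φ Ψ : 𝓢(EuclideanSpace ℝ (Fin n), EuclideanSpace 𝕜 (Fin N)))

lemma grad_apply (x : EuclideanSpace ℝ (Fin n)) (p : Fin N × Fin n) :
    grad Φ x p = pd p.2 Φ x p.1 := by
  simp [grad, gradIncl_apply]

lemma hess_apply (x : EuclideanSpace ℝ (Fin n)) (p : Fin N × Fin n × Fin n) :
    hess Φ x p = pd p.2.1 (pd p.2.2 Φ) x p.1 := by
  have h : ∀ i j : Fin n, (p.2 = (i, j)) = (p.2.1 = i ∧ p.2.2 = j) := fun i j => by
    rw [Prod.ext_iff]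
  simp [hess, secondOrder_apply, hessIncl_apply, h, ite_and]

lemma op_apply (A : Tensor N n) (x : EuclideanSpace ℝ (Fin n)) (α : Fin N) :
    A.op Φ x α = ∑ β, ∑ i, ∑ j, (A α β i j : 𝕜) * hess Φ x (β, i, j) := by
  simp only [Tensor.op, secondOrder_apply, WithLp.ofLp_sum, Finset.sum_apply, matAction_apply,
    hess_apply, Matrix.of_apply]
  rw [Finset.sum_comm' (t' := Finset.univ) (s' := fun _ => Finset.univ) (by simp)]
  calc _ = ∑ j, ∑ i, ∑ β, (A α β i j : 𝕜) * pd i (pd j Φ) x β := rfl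
    _ = ∑ i, ∑ j, ∑ β, (A α β i j : 𝕜) * pd i (pd j Φ) x β := Finset.sum_comm
    _ = ∑ i, ∑ β, ∑ j, (A α β i j : 𝕜) * pd i (pd j Φ) x β :=
        Finset.sum_congr rfl fun i _ => Finset.sum_comm
    _ = _ := Finset.sum_comm

lemma contract_hess (A : Tensor N n)
    (Φ : 𝓢(EuclideanSpace ℝ (Fin n), EuclideanSpace ℝ (Fin N))) (x : EuclideanSpace ℝ (Fin n)) :
    A.contract (hess Φ x) = A.op Φ x := by
  ext α
  rw [op_apply]
  rfl

lemma op_sub (A : Tensor N n) : A.op (Φ - Ψ) = A.op Φ - A.op Ψ := secondOrder_sub _ _ _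

lemma hess_sub : hess (Φ - Ψ) = hess Φ - hess Ψ := secondOrder_sub _ _ _

lemma grad_sub : grad (Φ - Ψ) = grad Φ - grad Ψ := by
  simp only [grad, pd_sub, map_sub, Finset.sum_sub_distrib]

lemma norm_pd_pd_le (i j : Fin n) (x : EuclideanSpace ℝ (Fin n)) :
    ‖pd i (pd j Φ) x‖ ≤ ‖hess Φ x‖ := by
  rw [← sq_le_sq₀ (norm_nonneg _) (norm_nonneg _), EuclideanSpace.norm_sq_eq,
    EuclideanSpace.norm_sq_eq, Fintype.sum_prod_type]
  refine Finset.sum_le_sum fun α _ => ?_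
  have h := Finset.single_le_sum (f := fun p : Fin n × Fin n => ‖hess Φ x (α, p)‖ ^ 2)
    (fun _ _ => by positivity) (Finset.mem_univ (i, j))
  simpa only [hess_apply] using h

lemma norm_grad_le (x : EuclideanSpace ℝ (Fin n)) : ‖grad Φ x‖ ≤ ∑ i, ‖pd i Φ x‖ := by
  have h : grad Φ x = ∑ i, gradIncl 𝕜 i (pd i Φ x) := by simp [grad]
  rw [h]
  refine norm_sum_le_of_le _ fun i _ => le_of_eq ?_
  rw [← sq_eq_sq₀ (norm_nonneg _) (norm_nonneg _), EuclideanSpace.norm_sq_eq,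
    EuclideanSpace.norm_sq_eq, Fintype.sum_prod_type]
  simp [gradIncl_apply, apply_ite norm]

end Hessian

/-! ### Plancherel estimates -/

section Plancherel

variable {n : ℕ} {V W : Type*} [NormedAddCommGroup V] [InnerProductSpace ℂ V] [CompleteSpace V]
  [NormedAddCommGroup W] [InnerProductSpace ℂ W] [CompleteSpace W]

lemma eLpNorm_fourierInv (φ : 𝓢(EuclideanSpace ℝ (Fin n), V)) :
    eLpNorm (𝓕⁻ φ : 𝓢(EuclideanSpace ℝ (Fin n), V)) 2 volume = eLpNorm φ 2 volume := by
  have h := SchwartzMap.norm_fourier_toL2_eq (𝓕⁻ φ)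
  rw [FourierTransform.fourier_fourierInv_eq, SchwartzMap.norm_toLp, SchwartzMap.norm_toLp] at h
  exact ((ENNReal.toReal_eq_toReal_iff' (φ.eLpNorm_lt_top 2 volume).ne
    ((𝓕⁻ φ).eLpNorm_lt_top 2 volume).ne).1 h).symm

omit [CompleteSpace V] in
lemma fourierInv_pd_pd (φ : 𝓢(EuclideanSpace ℝ (Fin n), V)) (i j : Fin n)
    (z : EuclideanSpace ℝ (Fin n)) :
    (𝓕⁻ (pd i (pd j φ)) : 𝓢(EuclideanSpace ℝ (Fin n), V)) z =
      (-(4 * Real.pi ^ 2 * (z i * z j)) : ℝ) • (𝓕⁻ φ) z := by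
  have ht : ∀ m : EuclideanSpace ℝ (Fin n),
      (fun x : EuclideanSpace ℝ (Fin n) => inner ℝ x m).HasTemperateGrowth := fun m => by fun_prop
  have hI : ∀ k : Fin n, inner ℝ z (basisVec k) = z k := fun k => by
    simp [basisVec, EuclideanSpace.inner_single_right]
  simp only [pd, SchwartzMap.fourierInv_lineDerivOp_eq]
  simp only [smul_apply, SchwartzMap.smulLeftCLM_apply_apply (ht _), hI]
  rw [← Complex.coe_smul, ← Complex.coe_smul, ← Complex.coe_smul]
  simp only [smul_smul]
  congr 1
  push_cast
  linear_combination (4 * (Real.pi : ℂ) ^ 2 * (z i * z j)) * Complex.I_sq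

lemma fourierInv_postcompCLM (T : V →L[ℂ] W) (φ : 𝓢(EuclideanSpace ℝ (Fin n), V))
    (z : EuclideanSpace ℝ (Fin n)) :
    (𝓕⁻ (φ.postcompCLM T) : 𝓢(EuclideanSpace ℝ (Fin n), W)) z = T (𝓕⁻ φ z) := by
  rw [SchwartzMap.fourierInv_coe, SchwartzMap.fourierInv_coe, Real.fourierInv_eq,
    Real.fourierInv_eq, ← T.integral_comp_comm]
  · simp [Circle.smul_def]
  · simpa using (Real.fourierIntegral_convergent_iff (-z)).2 φ.integrable

lemma fourierInv_secondOrder (T : Fin n → Fin n → V →L[ℂ] W)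
    (φ : 𝓢(EuclideanSpace ℝ (Fin n), V)) (z : EuclideanSpace ℝ (Fin n)) :
    (𝓕⁻ (secondOrder T φ) : 𝓢(EuclideanSpace ℝ (Fin n), W)) z =
      (-(4 * Real.pi ^ 2) : ℝ) • ∑ i, ∑ j, (z i * z j) • T i j (𝓕⁻ φ z) := by
  have hsum : 𝓕⁻ (secondOrder T φ) =
      ∑ i, ∑ j, (𝓕⁻ ((pd i (pd j φ)).postcompCLM (T i j)) : 𝓢(EuclideanSpace ℝ (Fin n), W)) := by
    change FourierTransform.fourierInvCLM ℂ 𝓢(EuclideanSpace ℝ (Fin n), W) (secondOrder T φ) = _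
    simp only [secondOrder, map_sum]
    rfl
  simp only [hsum, sum_apply, fourierInv_postcompCLM, fourierInv_pd_pd, Finset.smul_sum]
  refine Finset.sum_congr rfl fun i _ => Finset.sum_congr rfl fun j _ => ?_
  rw [← Complex.coe_smul, map_smul, ← Complex.coe_smul, ← Complex.coe_smul, smul_smul]
  congr 1
  push_cast
  ring

variable {N : ℕ}

lemma fourierInv_op (A : Tensor N n) (Φ : 𝓢(EuclideanSpace ℝ (Fin n), EuclideanSpace ℂ (Fin N)))
    (z : EuclideanSpace ℝ (Fin n)) :
    (𝓕⁻ (A.op Φ) : 𝓢(EuclideanSpace ℝ (Fin n), EuclideanSpace ℂ (Fin N))) z =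
      (-(4 * Real.pi ^ 2) : ℝ) • matAction ℂ (A.acoustic z) (𝓕⁻ Φ z) := by
  rw [Tensor.op, fourierInv_secondOrder, matAction_acoustic]

lemma norm_fourierInv_hess (Φ : 𝓢(EuclideanSpace ℝ (Fin n), EuclideanSpace ℂ (Fin N)))
    (z : EuclideanSpace ℝ (Fin n)) :
    ‖(𝓕⁻ (hess Φ) : 𝓢(EuclideanSpace ℝ (Fin n), EuclideanSpace ℂ (Fin N × Fin n × Fin n))) z‖ =
      4 * Real.pi ^ 2 * (‖z‖ ^ 2 * ‖𝓕⁻ Φ z‖) := by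
  rw [hess, fourierInv_secondOrder, norm_smul, norm_neg, Real.norm_of_nonneg (by positivity)]
  congr 1
  rw [← sq_eq_sq₀ (norm_nonneg _) (by positivity), mul_pow, EuclideanSpace.norm_sq_eq]
  have h : ∀ p : Fin N × Fin n × Fin n,
      (∑ i, ∑ j, (z i * z j) • hessIncl ℂ i j (𝓕⁻ Φ z)) p = (z p.2.1 * z p.2.2) • (𝓕⁻ Φ) z p.1 := by
    intro p
    have h : ∀ i j : Fin n, (p.2 = (i, j)) = (p.2.1 = i ∧ p.2.2 = j) := fun i j => by
      rw [Prod.ext_iff]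
    simp [hessIncl_apply, h, ite_and]
  simp only [h, norm_smul, mul_pow, Fintype.sum_prod_type, norm_mul]
  have hv : ‖(𝓕⁻ Φ) z‖ ^ 2 = ∑ α, ‖(𝓕⁻ Φ) z α‖ ^ 2 := EuclideanSpace.norm_sq_eq _
  rw [hv, Finset.mul_sum]
  refine Finset.sum_congr rfl fun α _ => ?_
  simp only [← Finset.sum_mul, ← Finset.mul_sum]
  rw [EuclideanSpace.norm_sq_eq z]
  ring

/-- By Plancherel's theorem the hessian is controlled by `A : D²Φ`, with the sharp constant. -/
lemma eLpNorm_hess_le_complex {A : Tensor N n} (hpos : 0 < A.ellipticityConst)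
    (hA : A.IsRankOnePositive) (Φ : 𝓢(EuclideanSpace ℝ (Fin n), EuclideanSpace ℂ (Fin N))) :
    eLpNorm (hess Φ) 2 volume ≤
      ENNReal.ofReal (1 / A.ellipticityConst) * eLpNorm (A.op Φ) 2 volume := by
  rw [← eLpNorm_fourierInv (hess Φ), ← eLpNorm_fourierInv (A.op Φ)]
  refine eLpNorm_le_mul_eLpNorm_of_ae_le_mul (ae_of_all _ fun z => ?_) 2
  rw [norm_fourierInv_hess, fourierInv_op, norm_smul, norm_neg,
    Real.norm_of_nonneg (by positivity)]
  have h := le_norm_matAction_acoustic hA z (𝓕⁻ Φ z)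
  rw [div_mul_eq_mul_div, one_mul, le_div_iff₀ hpos]
  calc _ = 4 * Real.pi ^ 2 * (A.ellipticityConst * ‖z‖ ^ 2 * ‖𝓕⁻ Φ z‖) := by ring
    _ ≤ _ := by gcongr

/-- Componentwise complexification, as a continuous linear map. -/
def toComplexCLM : EuclideanSpace ℝ (Fin N) →L[ℝ] EuclideanSpace ℂ (Fin N) :=
  LinearMap.toContinuousLinearMap
    { toFun := toComplex
      map_add' := fun v w => by
        ext α
        simp [toComplex]
      map_smul' := fun c v => by
        ext α
        simp [toComplex] }

lemma toComplexCLM_apply (v : EuclideanSpace ℝ (Fin N)) : toComplexCLM v = toComplex v := rfl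

lemma norm_toComplex (v : EuclideanSpace ℝ (Fin N)) : ‖toComplex v‖ = ‖v‖ := by
  rw [← sq_eq_sq₀ (norm_nonneg _) (norm_nonneg _), EuclideanSpace.norm_sq_eq,
    EuclideanSpace.norm_sq_eq]
  simp [toComplex]

/-- The complexification of a real vector-valued Schwartz function. -/
def complexify (Φ : 𝓢(EuclideanSpace ℝ (Fin n), EuclideanSpace ℝ (Fin N))) :
    𝓢(EuclideanSpace ℝ (Fin n), EuclideanSpace ℂ (Fin N)) :=
  Φ.postcompCLM toComplexCLM

lemma complexify_apply (Φ : 𝓢(EuclideanSpace ℝ (Fin n), EuclideanSpace ℝ (Fin N)))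
    (x : EuclideanSpace ℝ (Fin n)) : complexify Φ x = toComplex (Φ x) := rfl

lemma complexify_sub (Φ Ψ : 𝓢(EuclideanSpace ℝ (Fin n), EuclideanSpace ℝ (Fin N))) :
    complexify (Φ - Ψ) = complexify Φ - complexify Ψ := map_sub _ _ _

lemma hess_complexify (Φ : 𝓢(EuclideanSpace ℝ (Fin n), EuclideanSpace ℝ (Fin N)))
    (x : EuclideanSpace ℝ (Fin n)) (p : Fin N × Fin n × Fin n) :
    hess (complexify Φ) x p = (hess Φ x p : ℂ) := by
  rw [hess_apply, hess_apply, complexify, pd_postcompCLM, pd_postcompCLM]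
  rfl

lemma op_complexify (A : Tensor N n)
    (Φ : 𝓢(EuclideanSpace ℝ (Fin n), EuclideanSpace ℝ (Fin N))) :
    A.op (complexify Φ) = complexify (A.op Φ) := by
  ext x α
  rw [op_apply, complexify_apply, toComplex, PiLp.toLp_apply, op_apply]
  simp [hess_complexify]

lemma eLpNorm_hess_le {A : Tensor N n} (hpos : 0 < A.ellipticityConst)
    (hA : A.IsRankOnePositive) (Φ : 𝓢(EuclideanSpace ℝ (Fin n), EuclideanSpace ℝ (Fin N))) :
    eLpNorm (hess Φ) 2 volume ≤
      ENNReal.ofReal (1 / A.ellipticityConst) * eLpNorm (A.op Φ) 2 volume := by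
  have h := eLpNorm_hess_le_complex hpos hA (complexify Φ)
  have h1 : eLpNorm (hess (complexify Φ)) 2 volume = eLpNorm (hess Φ) 2 volume := by
    refine eLpNorm_congr_norm_ae (ae_of_all _ fun x => ?_)
    rw [← sq_eq_sq₀ (norm_nonneg _) (norm_nonneg _), EuclideanSpace.norm_sq_eq,
      EuclideanSpace.norm_sq_eq]
    simp [hess_complexify]
  have h2 : eLpNorm (A.op (complexify Φ)) 2 volume = eLpNorm (A.op Φ) 2 volume := by
    rw [op_complexify]
    exact eLpNorm_congr_norm_ae (ae_of_all _ fun x => norm_toComplex _)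
  rwa [h1, h2] at h

/-- `‖𝓕 ψ‖_{L^{2**}} ≤ C ‖|z|² ψ‖_{L²}`: the Sobolev inequality on the Fourier side. -/
lemma exists_eLpNorm_fourier_le (hn : 5 ≤ n) (N : ℕ) : ∃ C : ℝ≥0,
    ∀ ψ : 𝓢(EuclideanSpace ℝ (Fin n), EuclideanSpace ℂ (Fin N)),
      eLpNorm (𝓕 ψ : 𝓢(EuclideanSpace ℝ (Fin n), EuclideanSpace ℂ (Fin N))) (expStarStar n) volume ≤
        C * eLpNorm (fun z => ‖z‖ ^ 2 * ‖ψ z‖) 2 volume := by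
  obtain ⟨C, hC⟩ := exists_sobolev_expStarStar hn
  refine ⟨C * ∑ _j : Fin n, ∑ _i : Fin n, (4 * Real.pi ^ 2).toNNReal, fun ψ => (hC _).trans ?_⟩
  push_cast
  rw [mul_assoc, Finset.sum_mul]
  gcongr with j _
  rw [Finset.sum_mul]
  gcongr with i _
  rw [← eLpNorm_fourierInv]
  refine eLpNorm_le_mul_eLpNorm_of_ae_le_mul (ae_of_all _ fun z => ?_) 2
  rw [fourierInv_pd_pd, FourierTransform.fourierInv_fourier_eq, norm_smul, norm_neg, norm_mul,
    Real.norm_of_nonneg (r := 4 * Real.pi ^ 2) (by positivity),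
    Real.norm_of_nonneg (r := ‖z‖ ^ 2 * ‖ψ z‖) (by positivity), mul_assoc, norm_mul, sq ‖z‖]
  have hij : ‖z i‖ * ‖z j‖ ≤ ‖z‖ * ‖z‖ := mul_le_mul (PiLp.norm_apply_le z i)
    (PiLp.norm_apply_le z j) (norm_nonneg _) (norm_nonneg _)
  gcongr

end Plancherel

/-! ### Density of the range of the operator -/

section Density

variable {N n : ℕ} {A : Tensor N n}

/-- Componentwise real part. -/
def reCLM : EuclideanSpace ℂ (Fin N) →L[ℝ] EuclideanSpace ℝ (Fin N) :=
  LinearMap.toContinuousLinearMap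
    { toFun := fun v => WithLp.toLp 2 fun α => (v α).re
      map_add' := fun v w => by
        ext α
        simp
      map_smul' := fun c v => by
        ext α
        simp }

/-- Componentwise imaginary part. -/
def imCLM : EuclideanSpace ℂ (Fin N) →L[ℝ] EuclideanSpace ℝ (Fin N) :=
  LinearMap.toContinuousLinearMap
    { toFun := fun v => WithLp.toLp 2 fun α => (v α).im
      map_add' := fun v w => by
        ext α
        simp
      map_smul' := fun c v => by
        ext α
        simp }

lemma reCLM_apply (v : EuclideanSpace ℂ (Fin N)) (α : Fin N) : reCLM v α = (v α).re := rfl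

lemma imCLM_apply (v : EuclideanSpace ℂ (Fin N)) (α : Fin N) : imCLM v α = (v α).im := rfl

lemma op_postcomp_re (A : Tensor N n)
    (Ψ : 𝓢(EuclideanSpace ℝ (Fin n), EuclideanSpace ℂ (Fin N))) (x : EuclideanSpace ℝ (Fin n)) :
    A.op (Ψ.postcompCLM reCLM) x = reCLM (A.op Ψ x) := by
  ext α
  simp [op_apply, hess_apply, pd_postcompCLM, reCLM_apply]

lemma op_postcomp_im (A : Tensor N n)
    (Ψ : 𝓢(EuclideanSpace ℝ (Fin n), EuclideanSpace ℂ (Fin N))) (x : EuclideanSpace ℝ (Fin n)) :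
    A.op (Ψ.postcompCLM imCLM) x = imCLM (A.op Ψ x) := by
  ext α
  simp [op_apply, hess_apply, pd_postcompCLM, imCLM_apply]

lemma inner_toComplex (w : EuclideanSpace ℂ (Fin N)) (v : EuclideanSpace ℝ (Fin N)) :
    (inner ℂ w (toComplex v)).re = inner ℝ (reCLM w) v ∧
      (inner ℂ w (toComplex v)).im = -inner ℝ (imCLM w) v := by
  simp [PiLp.inner_apply, toComplex, reCLM_apply, imCLM_apply]

lemma memLp_toComplex {f : EuclideanSpace ℝ (Fin n) → EuclideanSpace ℝ (Fin N)} {p : ℝ≥0∞}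
    (hf : MemLp f p volume) : MemLp (fun x => toComplex (f x)) p volume :=
  hf.continuousLinearMap_comp toComplexCLM

lemma inner_fourierInv_Lp (f g : Lp (EuclideanSpace ℂ (Fin N)) 2
    (volume : Measure (EuclideanSpace ℝ (Fin n)))) : inner ℂ (𝓕⁻ f) (𝓕⁻ g) = inner ℂ f g :=
  (Lp.fourierTransformₗᵢ (EuclideanSpace ℝ (Fin n)) (EuclideanSpace ℂ (Fin N))).symm.inner_map_map
    f g

/-- The range of `Φ ↦ A : D²Φ` has no orthogonal complement in `L²`: on the Fourier side its
elements are pointwise orthogonal to the ranges of the invertible matrices `A : z ⊗ z`. -/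
lemma ae_eq_zero_of_integral_inner_op (hn : 0 < n) (hpos : 0 < A.ellipticityConst)
    (hA : A.IsRankOnePositive) {g : EuclideanSpace ℝ (Fin n) → EuclideanSpace ℝ (Fin N)}
    (hg : MemLp g 2 volume)
    (h : ∀ Φ : 𝓢(EuclideanSpace ℝ (Fin n), EuclideanSpace ℝ (Fin N)),
      ∫ x, inner ℝ (A.op Φ x) (g x) = 0) : g =ᵐ[volume] 0 := by
  set G : Lp (EuclideanSpace ℂ (Fin N)) 2 (volume : Measure (EuclideanSpace ℝ (Fin n))) :=
    (memLp_toComplex hg).toLp with hG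
  have hGae : G =ᵐ[volume] fun x => toComplex (g x) := MemLp.coeFn_toLp _
  -- the hypothesis holds for complex test functions as well
  have h1 : ∀ Ψ : 𝓢(EuclideanSpace ℝ (Fin n), EuclideanSpace ℂ (Fin N)),
      inner ℂ ((A.op Ψ).toLp 2) G = 0 := by
    intro Ψ
    have hae : (fun x => inner ℂ ((A.op Ψ).toLp 2 volume x) (G x)) =ᵐ[volume]
        fun x => inner ℂ (A.op Ψ x) (toComplex (g x)) := by
      filter_upwards [hGae, (A.op Ψ).coeFn_toLp 2 volume] with x hx hx'
      rw [hx, hx']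
    have hint : Integrable fun x => inner ℂ (A.op Ψ x) (toComplex (g x)) :=
      (L2.integrable_inner ((A.op Ψ).toLp 2 volume) G).congr hae
    rw [L2.inner_def, integral_congr_ae hae]
    refine Complex.ext ?_ ?_
    · have h2 := Complex.reCLM.integral_comp_comm hint
      simp only [Complex.reCLM_apply, (inner_toComplex _ _).1, ← op_postcomp_re, h] at h2
      exact h2.symm
    · have h2 := Complex.imCLM.integral_comp_comm hint
      simp only [Complex.imCLM_apply, (inner_toComplex _ _).2, ← op_postcomp_im, integral_neg, h,
        neg_zero] at h2
      exact h2.symm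
  set Γ : Lp (EuclideanSpace ℂ (Fin N)) 2 (volume : Measure (EuclideanSpace ℝ (Fin n))) := 𝓕⁻ G
    with hΓ
  -- transport to the Fourier side
  have h2 : ∀ ψ : 𝓢(EuclideanSpace ℝ (Fin n), EuclideanSpace ℂ (Fin N)),
      ∫ z, inner ℂ (matAction ℂ (A.acoustic z) (ψ z)) (Γ z) = 0 := by
    intro ψ
    have h3 := h1 (𝓕 ψ)
    rw [← inner_fourierInv_Lp, SchwartzMap.toLp_fourierInv_eq, L2.inner_def] at h3
    have hae : (fun z => inner ℂ
        ((𝓕⁻ (A.op (𝓕 ψ)) : 𝓢(EuclideanSpace ℝ (Fin n), EuclideanSpace ℂ (Fin N))).toLp 2 volume z)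
          (Γ z)) =ᵐ[volume]
        fun z => ((-(4 * Real.pi ^ 2) : ℝ) : ℂ) *
          inner ℂ (matAction ℂ (A.acoustic z) (ψ z)) (Γ z) := by
      filter_upwards [(𝓕⁻ (A.op (𝓕 ψ)) :
        𝓢(EuclideanSpace ℝ (Fin n), EuclideanSpace ℂ (Fin N))).coeFn_toLp 2 volume] with z hz
      rw [hz, fourierInv_op, FourierTransform.fourierInv_fourier_eq, ← Complex.coe_smul,
        inner_smul_left, Complex.conj_ofReal]
    rw [integral_congr_ae hae, integral_const_mul] at h3
    refine (mul_eq_zero.1 h3).resolve_left ?_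
    simp [Real.pi_ne_zero]
  have h3 : ∀ α, ∀ᵐ z,
      inner ℂ (matAction ℂ (A.acoustic z) (EuclideanSpace.single α 1)) (Γ z) = 0 := by
    intro α
    have hcont : Continuous fun z : EuclideanSpace ℝ (Fin n) =>
        matAction ℂ (A.acoustic z) (EuclideanSpace.single α 1) := by
      simp only [matAction_acoustic]
      fun_prop
    refine ae_eq_zero_of_integral_contDiff_smul_eq_zero ?_ fun χ hχ hχc => ?_
    · simp only [PiLp.inner_apply, RCLike.inner_apply]
      refine locallyIntegrable_finsetSum _ fun β _ => ?_
      rw [← locallyIntegrableOn_univ]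
      refine LocallyIntegrableOn.mul_continuousOn ?_ ?_ isOpen_univ.isLocallyClosed
      · rw [locallyIntegrableOn_univ]
        exact ((Lp.memLp Γ).eval_piLp β).locallyIntegrable one_le_two
      · exact (Complex.continuous_conj.comp
          ((EuclideanSpace.proj (𝕜 := ℂ) β).continuous.comp hcont)).continuousOn
    · set ψ : 𝓢(EuclideanSpace ℝ (Fin n), EuclideanSpace ℂ (Fin N)) :=
        (hχc.smul_right (f' := fun _ => (EuclideanSpace.single α (1 : ℂ)))).toSchwartzMap
          (hχ.smul contDiff_const)
      refine Eq.trans (integral_congr_ae (ae_of_all _ fun z => ?_)) (h2 ψ)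
      have : ψ z = χ z • EuclideanSpace.single α (1 : ℂ) := rfl
      simp only [this]
      rw [← Complex.coe_smul, ← Complex.coe_smul, map_smul, inner_smul_left, Complex.conj_ofReal,
        smul_eq_mul]
  have h4 : Γ = 0 := by
    rw [Lp.eq_zero_iff_ae_eq_zero]
    have hz : ∀ᵐ z : EuclideanSpace ℝ (Fin n), z ≠ 0 := by
      have : Nonempty (Fin n) := ⟨⟨0, hn⟩⟩
      simp [ae_iff]
    filter_upwards [hz, ae_all_iff.2 h3] with z hz hz3
    have hdet := det_acoustic_ne_zero hpos hA hz
    set v := matAction ℂ (A.acoustic z)⁻¹ (Γ z) with hv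
    have h5 : matAction ℂ (A.acoustic z) v = Γ z := by
      rw [hv, ← matAction_mul, Matrix.mul_nonsing_inv _ (isUnit_iff_ne_zero.2 hdet), matAction_one]
    have h6 : v = ∑ α, v α • EuclideanSpace.single α (1 : ℂ) := by
      ext β
      simp [Pi.single_apply]
    have h7 : inner ℂ (matAction ℂ (A.acoustic z) v) (Γ z) = 0 := by
      rw [h6, map_sum, sum_inner]
      refine Finset.sum_eq_zero fun α _ => ?_
      rw [map_smul, inner_smul_left, hz3, mul_zero]
    rw [h5] at h7
    exact inner_self_eq_zero.1 h7
  have h5 : G = 0 := by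
    have : 𝓕 Γ = G := FourierTransform.fourier_fourierInv_eq G
    rw [← norm_eq_zero, ← this, Lp.norm_fourier_eq, h4, norm_zero]
  filter_upwards [hGae, (Lp.eq_zero_iff_ae_eq_zero.1 h5)] with x hx hx'
  rw [hx'] at hx
  have : ‖toComplex (g x)‖ = 0 := by rw [← hx]; simp
  rw [norm_toComplex] at this
  simpa using this

/-- Every `f ∈ L²` is a limit of functions `A : D²Φ` with `Φ` a Schwartz function. -/
lemma exists_seq_op_tendsto (hn : 0 < n) (hpos : 0 < A.ellipticityConst) (hA : A.IsRankOnePositive)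
    {f : EuclideanSpace ℝ (Fin n) → EuclideanSpace ℝ (Fin N)} (hf : MemLp f 2 volume) :
    ∃ Φ : ℕ → 𝓢(EuclideanSpace ℝ (Fin n), EuclideanSpace ℝ (Fin N)),
      Tendsto (fun k => eLpNorm (⇑(A.op (Φ k)) - f) 2 volume) atTop (𝓝 0) := by
  let T : 𝓢(EuclideanSpace ℝ (Fin n), EuclideanSpace ℝ (Fin N)) →L[ℝ]
      Lp (EuclideanSpace ℝ (Fin N)) 2 (volume : Measure (EuclideanSpace ℝ (Fin n))) :=
    SchwartzMap.toLpCLM ℝ (EuclideanSpace ℝ (Fin N)) 2 volume ∘L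
      ∑ i, ∑ j, SchwartzMap.postcompCLM (matAction ℝ (Matrix.of fun α β => A α β i j)) ∘L
        LineDeriv.lineDerivOpCLM ℝ 𝓢(EuclideanSpace ℝ (Fin n), EuclideanSpace ℝ (Fin N))
          (basisVec i) ∘L
        LineDeriv.lineDerivOpCLM ℝ 𝓢(EuclideanSpace ℝ (Fin n), EuclideanSpace ℝ (Fin N))
          (basisVec j)
  have hT : ∀ Φ, T Φ = (A.op Φ).toLp 2 volume := fun Φ => by
    simp only [T, ContinuousLinearMap.comp_apply, sum_apply, SchwartzMap.toLpCLM_apply]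
    rfl
  have hd : T.range.topologicalClosure = ⊤ := by
    rw [Submodule.topologicalClosure_eq_top_iff, Submodule.eq_bot_iff]
    intro g hg
    rw [Lp.eq_zero_iff_ae_eq_zero]
    refine ae_eq_zero_of_integral_inner_op hn hpos hA (Lp.memLp g) fun Φ => ?_
    have h1 := (Submodule.mem_orthogonal _ _).1 hg (T Φ) ⟨Φ, rfl⟩
    rw [hT, L2.inner_def] at h1
    rw [← h1]
    refine integral_congr_ae ?_
    filter_upwards [(A.op Φ).coeFn_toLp 2 volume] with x hx
    rw [hx]
  have hmem : hf.toLp f ∈ closure (T.range : Set _) := by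
    rw [← Submodule.topologicalClosure_coe, hd]
    trivial
  obtain ⟨b, hb, hlim⟩ := mem_closure_iff_seq_limit.1 hmem
  choose Φ hΦ using hb
  refine ⟨Φ, ?_⟩
  refine (Lp.tendsto_Lp_iff_tendsto_eLpNorm'' (fun k => ⇑(A.op (Φ k)))
    (fun k => (A.op (Φ k)).memLp 2 volume) f hf).1 (hlim.congr fun k => ?_)
  rw [← hΦ]
  exact hT _

end Density

/-! ### Existence and uniqueness -/

section Solutions

variable {N n : ℕ} {A : Tensor N n}

/-- The three a priori estimates for Schwartz functions. -/
lemma exists_apriori (hn : 5 ≤ n) (hpos : 0 < A.ellipticityConst) (hA : A.IsRankOnePositive) :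
    ∃ C : ℝ≥0, ∀ Φ : 𝓢(EuclideanSpace ℝ (Fin n), EuclideanSpace ℝ (Fin N)),
      eLpNorm Φ (expStarStar n) volume ≤ C * eLpNorm (A.op Φ) 2 volume ∧
      eLpNorm (grad Φ) (expStar n) volume ≤ C * eLpNorm (A.op Φ) 2 volume ∧
      eLpNorm (hess Φ) 2 volume ≤ C * eLpNorm (A.op Φ) 2 volume := by
  obtain ⟨C₁, h₁⟩ := exists_sobolev_expStar hn
  obtain ⟨C₂, h₂⟩ := exists_sobolev_expStarStar hn
  set ν : ℝ≥0 := (1 / A.ellipticityConst).toNNReal with hν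
  have hH : ∀ Φ : 𝓢(EuclideanSpace ℝ (Fin n), EuclideanSpace ℝ (Fin N)),
      eLpNorm (hess Φ) 2 volume ≤ ν * eLpNorm (A.op Φ) 2 volume := fun Φ =>
    eLpNorm_hess_le hpos hA Φ
  have hpd : ∀ (Φ : 𝓢(EuclideanSpace ℝ (Fin n), EuclideanSpace ℝ (Fin N))) (i j : Fin n),
      eLpNorm (pd i (pd j Φ)) 2 volume ≤ ν * eLpNorm (A.op Φ) 2 volume := fun Φ i j =>
    (eLpNorm_mono fun x => norm_pd_pd_le Φ i j x).trans (hH Φ)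
  refine ⟨max ν (max (C₂ * ∑ _j : Fin n, ∑ _i : Fin n, ν) (∑ _j : Fin n, C₁ * ∑ _i : Fin n, ν)),
    fun Φ => ⟨?_, ?_, ?_⟩⟩
  · calc eLpNorm Φ (expStarStar n) volume
        ≤ C₂ * ∑ j : Fin n, ∑ i : Fin n, eLpNorm (pd i (pd j Φ)) 2 volume := h₂ Φ
      _ ≤ C₂ * ∑ j : Fin n, ∑ i : Fin n, ν * eLpNorm (A.op Φ) 2 volume := by
          gcongr
          exact hpd Φ _ _
      _ = ((C₂ * ∑ _j : Fin n, ∑ _i : Fin n, ν : ℝ≥0) : ℝ≥0∞) * eLpNorm (A.op Φ) 2 volume := by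
          push_cast
          simp only [← Finset.sum_mul, mul_assoc]
      _ ≤ _ := by
          gcongr
          exact (le_max_left _ _).trans (le_max_right _ _)
  · calc eLpNorm (grad Φ) (expStar n) volume
        ≤ eLpNorm (∑ j : Fin n, fun x => ‖pd j Φ x‖) (expStar n) volume := by
          refine eLpNorm_mono_real fun x => ?_
          rw [Finset.sum_apply]
          exact norm_grad_le Φ x
      _ ≤ ∑ j : Fin n, eLpNorm (fun x => ‖pd j Φ x‖) (expStar n) volume :=
          eLpNorm_sum_le (fun j _ => (pd j Φ).continuous.norm.aestronglyMeasurable)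
            (one_le_expStar hn)
      _ ≤ ∑ j : Fin n, C₁ * ∑ i : Fin n, eLpNorm (pd i (pd j Φ)) 2 volume := by
          gcongr with j _
          rw [eLpNorm_norm]
          exact h₁ _
      _ ≤ ∑ j : Fin n, C₁ * ∑ i : Fin n, ν * eLpNorm (A.op Φ) 2 volume := by
          gcongr
          exact hpd Φ _ _
      _ = ((∑ _j : Fin n, C₁ * ∑ _i : Fin n, ν : ℝ≥0) : ℝ≥0∞) * eLpNorm (A.op Φ) 2 volume := by
          push_cast
          simp only [← Finset.sum_mul, mul_assoc]
      _ ≤ _ := by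
          gcongr
          exact (le_max_right _ _).trans (le_max_right _ _)
  · refine (hH Φ).trans ?_
    gcongr
    exact le_max_left _ _

lemma tendsto_eLpNorm_apply {ι : Type*} [Fintype ι] {p : ℝ≥0∞}
    {a : ℕ → EuclideanSpace ℝ (Fin n) → EuclideanSpace ℝ ι}
    {b : EuclideanSpace ℝ (Fin n) → EuclideanSpace ℝ ι}
    (h : Tendsto (fun k => eLpNorm (a k - b) p volume) atTop (𝓝 0)) (i : ι) :
    Tendsto (fun k => eLpNorm ((fun x => a k x i) - fun x => b x i) p volume) atTop (𝓝 0) :=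
  tendsto_of_tendsto_of_tendsto_of_le_of_le tendsto_const_nhds h (fun _ => zero_le)
    fun k => eLpNorm_mono fun x => PiLp.norm_apply_le ((a k - b) x) i

/-- The contraction with `A`, as a continuous linear map. -/
def contractCLM (A : Tensor N n) :
    EuclideanSpace ℝ (Fin N × Fin n × Fin n) →L[ℝ] EuclideanSpace ℝ (Fin N) :=
  LinearMap.toContinuousLinearMap
    { toFun := A.contract
      map_add' := fun v w => by
        ext α
        simp [Tensor.contract, mul_add, Finset.sum_add_distrib]
      map_smul' := fun c v => by
        ext α
        simp [Tensor.contract, Finset.mul_sum, mul_left_comm] }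

lemma contractCLM_apply (Z : EuclideanSpace ℝ (Fin N × Fin n × Fin n)) :
    contractCLM A Z = A.contract Z := rfl

/-- The solution is the limit of Schwartz functions `Φ k` with `A : D²(Φ k) → f` in `L²`. -/
lemma exists_solution (hn : 5 ≤ n) (hpos : 0 < A.ellipticityConst) (hA : A.IsRankOnePositive)
    {C : ℝ≥0} (hC : ∀ Φ : 𝓢(EuclideanSpace ℝ (Fin n), EuclideanSpace ℝ (Fin N)),
      eLpNorm Φ (expStarStar n) volume ≤ C * eLpNorm (A.op Φ) 2 volume ∧
      eLpNorm (grad Φ) (expStar n) volume ≤ C * eLpNorm (A.op Φ) 2 volume ∧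
      eLpNorm (hess Φ) 2 volume ≤ C * eLpNorm (A.op Φ) 2 volume)
    {f : EuclideanSpace ℝ (Fin n) → EuclideanSpace ℝ (Fin N)} (hf : MemLp f 2 volume)
    {Φ : ℕ → 𝓢(EuclideanSpace ℝ (Fin n), EuclideanSpace ℝ (Fin N))}
    (hΦ : Tendsto (fun k => eLpNorm (⇑(A.op (Φ k)) - f) 2 volume) atTop (𝓝 0)) :
    ∃ (u : EuclideanSpace ℝ (Fin n) → EuclideanSpace ℝ (Fin N))
      (Du : EuclideanSpace ℝ (Fin n) → EuclideanSpace ℝ (Fin N × Fin n))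
      (D2u : EuclideanSpace ℝ (Fin n) → EuclideanSpace ℝ (Fin N × Fin n × Fin n)),
      IsW22Star u Du D2u ∧ (∀ᵐ x, A.contract (D2u x) = f x) ∧
      Tendsto (fun k => eLpNorm (⇑(Φ k) - u) (expStarStar n) volume) atTop (𝓝 0) ∧
      eLpNorm u (expStarStar n) volume ≤ C * eLpNorm f 2 volume ∧
      eLpNorm Du (expStar n) volume ≤ C * eLpNorm f 2 volume ∧
      eLpNorm D2u 2 volume ≤ C * eLpNorm f 2 volume ∧
      eLpNorm D2u 2 volume ≤ ENNReal.ofReal (1 / A.ellipticityConst) * eLpNorm f 2 volume := by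
  have hp1 := one_le_expStar hn
  have hp2 := one_le_expStarStar hn
  have hop : ∀ k, MemLp (A.op (Φ k)) 2 volume := fun k => (A.op (Φ k)).memLp 2 volume
  have hm0 : ∀ k, MemLp (Φ k) (expStarStar n) volume := fun k => (Φ k).memLp _ volume
  have hm1 : ∀ k, MemLp (grad (Φ k)) (expStar n) volume := fun k => (grad (Φ k)).memLp _ volume
  have hm2 : ∀ k, MemLp (hess (Φ k)) 2 volume := fun k => (hess (Φ k)).memLp 2 volume
  have hsub : ∀ {F : Type} [NormedAddCommGroup F] [NormedSpace ℝ F]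
      (φ ψ : 𝓢(EuclideanSpace ℝ (Fin n), F)), ⇑φ - ⇑ψ = ⇑(φ - ψ) := fun φ ψ => rfl
  obtain ⟨u, hu, hul⟩ := exists_lim_of_eLpNorm_sub_le hp2 one_le_two hm0 hop hf hΦ C fun k l => by
    rw [hsub, hsub, ← op_sub]
    exact (hC _).1
  obtain ⟨Du, hDu, hDul⟩ := exists_lim_of_eLpNorm_sub_le hp1 one_le_two hm1 hop hf hΦ C
    fun k l => by
      rw [hsub, hsub, ← op_sub, ← grad_sub]
      exact (hC _).2.1
  obtain ⟨D2u, hD2u, hD2ul⟩ := exists_lim_of_eLpNorm_sub_le one_le_two one_le_two hm2 hop hf hΦ C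
    fun k l => by
      rw [hsub, hsub, ← op_sub, ← hess_sub]
      exact (hC _).2.2
  have hfl := tendsto_eLpNorm_of_tendsto_eLpNorm_sub one_le_two hop hf hΦ
  have hfC := ENNReal.Tendsto.const_mul hfl (Or.inr (ENNReal.coe_ne_top (r := C)))
  have hul' := tendsto_eLpNorm_of_tendsto_eLpNorm_sub hp2 hm0 hu hul
  have hDul' := tendsto_eLpNorm_of_tendsto_eLpNorm_sub hp1 hm1 hDu hDul
  have hD2ul' := tendsto_eLpNorm_of_tendsto_eLpNorm_sub one_le_two hm2 hD2u hD2ul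
  refine ⟨u, Du, D2u, ⟨hu, hDu, hD2u, fun α i => ?_, fun α i j => ?_⟩, ?_, hul,
    le_of_tendsto_of_tendsto' hul' hfC fun k => (hC _).1,
    le_of_tendsto_of_tendsto' hDul' hfC fun k => (hC _).2.1,
    le_of_tendsto_of_tendsto' hD2ul' hfC fun k => (hC _).2.2,
    le_of_tendsto_of_tendsto' hD2ul'
      (ENNReal.Tendsto.const_mul hfl (Or.inr ENNReal.ofReal_ne_top))
      fun k => eLpNorm_hess_le hpos hA _⟩
  · refine HasWeakPartial.of_tendsto (fun k => ?_) hp2 hp1 (fun k => (hm0 k).eval_piLp α)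
      (fun k => (hm1 k).eval_piLp (α, i)) (hu.eval_piLp α) (hDu.eval_piLp (α, i))
      (tendsto_eLpNorm_apply hul α) (tendsto_eLpNorm_apply hDul (α, i))
    simp only [grad_apply]
    have h := hasWeakPartial_schwartz i ((Φ k).postcompCLM (EuclideanSpace.proj (𝕜 := ℝ) α))
    rw [pd_postcompCLM] at h
    exact h
  · refine HasWeakPartial.of_tendsto (fun k => ?_) hp1 one_le_two
      (fun k => (hm1 k).eval_piLp (α, j)) (fun k => (hm2 k).eval_piLp (α, i, j))
      (hDu.eval_piLp (α, j)) (hD2u.eval_piLp (α, i, j)) (tendsto_eLpNorm_apply hDul (α, j))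
      (tendsto_eLpNorm_apply hD2ul (α, i, j))
    simp only [grad_apply, hess_apply]
    have h := hasWeakPartial_schwartz i
      ((pd j (Φ k)).postcompCLM (EuclideanSpace.proj (𝕜 := ℝ) α))
    rw [pd_postcompCLM] at h
    exact h
  · -- both `f` and `A : D2u` are the `L²` limit of `A : D²(Φ k)`
    have hcm : MemLp (fun x => A.contract (D2u x)) 2 volume :=
      hD2u.continuousLinearMap_comp (contractCLM A)
    have h1 : Tendsto (fun k => eLpNorm (⇑(A.op (Φ k)) - fun x => A.contract (D2u x)) 2 volume)
        atTop (𝓝 0) := by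
      have h2 : Tendsto (fun k => ENNReal.ofReal ‖contractCLM A‖ *
          eLpNorm (⇑(hess (Φ k)) - D2u) 2 volume) atTop (𝓝 0) := by
        simpa using ENNReal.Tendsto.const_mul (a := ENNReal.ofReal ‖contractCLM A‖) hD2ul
          (Or.inr ENNReal.ofReal_ne_top)
      refine tendsto_of_tendsto_of_tendsto_of_le_of_le tendsto_const_nhds h2 (fun _ => zero_le)
        fun k => eLpNorm_le_mul_eLpNorm_of_ae_le_mul (ae_of_all _ fun x => ?_) 2
      rw [Pi.sub_apply, Pi.sub_apply, ← contract_hess, ← contractCLM_apply, ← contractCLM_apply,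
        ← map_sub]
      exact (contractCLM A).le_opNorm _
    have : Fact ((1 : ℝ≥0∞) ≤ 2) := ⟨one_le_two⟩
    have h3 := (Lp.tendsto_Lp_iff_tendsto_eLpNorm'' _ hop _ hcm).2 h1
    have h4 := (Lp.tendsto_Lp_iff_tendsto_eLpNorm'' _ hop _ hf).2 hΦ
    exact (MemLp.toLp_eq_toLp_iff hcm hf).1 (tendsto_nhds_unique h3 h4)

lemma integral_weak_hess {k l : Fin n} {w wl H : EuclideanSpace ℝ (Fin n) → ℝ} {p q : ℝ≥0∞}
    (hp : 1 ≤ p) (hq : 1 ≤ q) (h1 : HasWeakPartial l w wl) (h2 : HasWeakPartial k wl H)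
    (hw : MemLp w p volume) (hwl : MemLp wl q volume) (hH : MemLp H 2 volume)
    (φ : 𝓢(EuclideanSpace ℝ (Fin n), ℝ)) :
    ∫ x, H x * φ x = ∫ x, w x * pd l (pd k φ) x := by
  rw [h1.integral_schwartz hp hq hw hwl, h2.integral_schwartz hq one_le_two hwl hH, neg_neg]

/-- Solutions are unique: the hessian of a solution of the homogeneous system is orthogonal to
the range of `A : D²`, because partial derivatives commute and `A` is symmetric; hence it vanishes. -/
lemma solution_unique (hn : 5 ≤ n) (hpos : 0 < A.ellipticityConst) (hA : A.IsRankOnePositive)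
    (hsymm : A.IsSymm) {u v : EuclideanSpace ℝ (Fin n) → EuclideanSpace ℝ (Fin N)}
    {Du Dv : EuclideanSpace ℝ (Fin n) → EuclideanSpace ℝ (Fin N × Fin n)}
    {D2u D2v : EuclideanSpace ℝ (Fin n) → EuclideanSpace ℝ (Fin N × Fin n × Fin n)}
    (hu : IsW22Star u Du D2u) (hv : IsW22Star v Dv D2v)
    (h : ∀ᵐ x, A.contract (D2v x) = A.contract (D2u x)) : v =ᵐ[volume] u := by
  have hp1 := one_le_expStar hn
  have hp2 := one_le_expStarStar hn
  set w := v - u with hw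
  set Dw := Dv - Du with hDw
  set H := D2v - D2u with hH
  have hwm : MemLp w (expStarStar n) volume := hv.memLp.sub hu.memLp
  have hDwm : MemLp Dw (expStar n) volume := hv.memLp_grad.sub hu.memLp_grad
  have hHm : MemLp H 2 volume := hv.memLp_hess.sub hu.memLp_hess
  have hgrad : ∀ α i, HasWeakPartial i (fun x => w x α) (fun x => Dw x (α, i)) := fun α i =>
    (hv.weak_grad α i).sub (hu.weak_grad α i)
  have hhess : ∀ α i j, HasWeakPartial i (fun x => Dw x (α, j)) (fun x => H x (α, i, j)) :=
    fun α i j => (hv.weak_hess α i j).sub (hu.weak_hess α i j)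
  have hzero : ∀ᵐ x, A.contract (H x) = 0 := by
    filter_upwards [h] with x hx
    rw [← contractCLM_apply, hH, Pi.sub_apply, map_sub, contractCLM_apply, contractCLM_apply, hx,
      sub_self]
  -- both sides equal `∫ w_α ∂_i ∂_j ∂_k ∂_l φ`
  have hswap : ∀ (α : Fin N) (k l i j : Fin n) (φ : 𝓢(EuclideanSpace ℝ (Fin n), ℝ)),
      ∫ x, H x (α, k, l) * pd i (pd j φ) x = ∫ x, H x (α, j, i) * pd k (pd l φ) x := by
    intro α k l i j φ
    rw [integral_weak_hess hp2 hp1 (hgrad α l) (hhess α k l) (hwm.eval_piLp α)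
        (hDwm.eval_piLp (α, l)) (hHm.eval_piLp (α, k, l)),
      integral_weak_hess hp2 hp1 (hgrad α i) (hhess α j i) (hwm.eval_piLp α)
        (hDwm.eval_piLp (α, i)) (hHm.eval_piLp (α, j, i))]
    have hc : pd l (pd k (pd i (pd j φ))) = pd i (pd j (pd k (pd l φ))) := by
      rw [pd_comm k i, pd_comm l i, pd_comm k j, pd_comm l j, pd_comm l k]
    rw [hc]
  have hHz : ∀ k l : Fin n, (fun x => (WithLp.toLp 2 fun α => H x (α, k, l) :
      EuclideanSpace ℝ (Fin N))) =ᵐ[volume] 0 := by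
    intro k l
    refine ae_eq_zero_of_integral_inner_op (by omega) hpos hA
      (MemLp.of_eval_piLp fun α => hHm.eval_piLp (α, k, l)) fun Φ => ?_
    set φ : Fin N → 𝓢(EuclideanSpace ℝ (Fin n), ℝ) := fun β =>
      Φ.postcompCLM (EuclideanSpace.proj (𝕜 := ℝ) β) with hφ
    have hφd : ∀ β i j x, hess Φ x (β, i, j) = pd i (pd j (φ β)) x := fun β i j x => by
      rw [hess_apply, hφ, pd_postcompCLM, pd_postcompCLM]
      rfl
    have hI : ∀ (α β : Fin N) (i j k l : Fin n),
        Integrable fun x => A α β i j * (H x (α, k, l) * pd i (pd j (φ β)) x) :=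
      fun α β i j k l => (integrable_mul_schwartz one_le_two (hHm.eval_piLp (α, k, l)) _).const_mul _
    have hI' : ∀ (α β : Fin N) (i j : Fin n),
        Integrable fun x => A α β i j * (H x (α, j, i) * pd k (pd l (φ β)) x) :=
      fun α β i j => (integrable_mul_schwartz one_le_two (hHm.eval_piLp (α, j, i)) _).const_mul _
    have e1 : ∀ x, inner ℝ (A.op Φ x) (WithLp.toLp 2 fun α => H x (α, k, l) :
        EuclideanSpace ℝ (Fin N)) =
        ∑ α, ∑ β, ∑ i, ∑ j, A α β i j * (H x (α, k, l) * pd i (pd j (φ β)) x) := by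
      intro x
      simp only [PiLp.inner_apply, op_apply, hφd, RCLike.inner_apply, Finset.mul_sum, conj_trivial]
      refine Finset.sum_congr rfl fun α _ => Finset.sum_congr rfl fun β _ =>
        Finset.sum_congr rfl fun i _ => Finset.sum_congr rfl fun j _ => ?_
      simp only [RCLike.ofReal_real_eq_id, id]
      ring
    have e2 : ∀ᵐ x, ∑ α, ∑ β, ∑ i, ∑ j, A α β i j * (H x (α, j, i) * pd k (pd l (φ β)) x) = 0 := by
      filter_upwards [hzero] with x hx
      rw [Finset.sum_comm]
      refine Finset.sum_eq_zero fun β _ => ?_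
      have hβ : ∑ α, ∑ j, ∑ i, A β α j i * H x (α, j, i) = 0 :=
        congrArg (fun z : EuclideanSpace ℝ (Fin N) => z β) hx
      calc _ = (∑ α, ∑ j, ∑ i, A β α j i * H x (α, j, i)) * pd k (pd l (φ β)) x := by
            simp only [Finset.sum_mul]
            refine Finset.sum_congr rfl fun α _ => ?_
            rw [Finset.sum_comm]
            refine Finset.sum_congr rfl fun j _ => Finset.sum_congr rfl fun i _ => ?_
            rw [hsymm α β i j, mul_assoc]
        _ = 0 := by rw [hβ, zero_mul]
    calc ∫ x, inner ℝ (A.op Φ x) (WithLp.toLp 2 fun α => H x (α, k, l) :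
          EuclideanSpace ℝ (Fin N))
        = ∑ α, ∑ β, ∑ i, ∑ j, A α β i j * ∫ x, H x (α, k, l) * pd i (pd j (φ β)) x := by
          simp only [e1]
          rw [integral_finsetSum _ fun α _ => integrable_finsetSum _ fun β _ =>
            integrable_finsetSum _ fun i _ => integrable_finsetSum _ fun j _ => hI α β i j k l]
          refine Finset.sum_congr rfl fun α _ => ?_
          rw [integral_finsetSum _ fun β _ =>
            integrable_finsetSum _ fun i _ => integrable_finsetSum _ fun j _ => hI α β i j k l]
          refine Finset.sum_congr rfl fun β _ => ?_
          rw [integral_finsetSum _ fun i _ => integrable_finsetSum _ fun j _ => hI α β i j k l]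
          refine Finset.sum_congr rfl fun i _ => ?_
          rw [integral_finsetSum _ fun j _ => hI α β i j k l]
          exact Finset.sum_congr rfl fun j _ => integral_const_mul _ _
      _ = ∑ α, ∑ β, ∑ i, ∑ j, A α β i j * ∫ x, H x (α, j, i) * pd k (pd l (φ β)) x := by
          simp only [hswap _ k l]
      _ = ∫ x, ∑ α, ∑ β, ∑ i, ∑ j, A α β i j * (H x (α, j, i) * pd k (pd l (φ β)) x) := by
          symm
          rw [integral_finsetSum _ fun α _ => integrable_finsetSum _ fun β _ =>
            integrable_finsetSum _ fun i _ => integrable_finsetSum _ fun j _ => hI' α β i j]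
          refine Finset.sum_congr rfl fun α _ => ?_
          rw [integral_finsetSum _ fun β _ =>
            integrable_finsetSum _ fun i _ => integrable_finsetSum _ fun j _ => hI' α β i j]
          refine Finset.sum_congr rfl fun β _ => ?_
          rw [integral_finsetSum _ fun i _ => integrable_finsetSum _ fun j _ => hI' α β i j]
          refine Finset.sum_congr rfl fun i _ => ?_
          rw [integral_finsetSum _ fun j _ => hI' α β i j]
          exact Finset.sum_congr rfl fun j _ => integral_const_mul _ _
      _ = 0 := by
          rw [integral_congr_ae e2, integral_zero]
  -- `D²w = 0` forces `Dw = 0` and then `w = 0`, since both lie in Lebesgue spaces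
  let i₀ : Fin n := ⟨0, by omega⟩
  have hDwz : ∀ α, (fun x => Dw x (α, i₀)) =ᵐ[volume] 0 := fun α =>
    (hhess α i₀ i₀).ae_eq_zero hp1 ENNReal.ofReal_ne_top (hDwm.eval_piLp (α, i₀)) (by
      filter_upwards [hHz i₀ i₀] with x hx
      exact congrArg (fun z : EuclideanSpace ℝ (Fin N) => z α) hx)
  have hwz : ∀ α, (fun x => w x α) =ᵐ[volume] 0 := fun α =>
    (hgrad α i₀).ae_eq_zero hp2 ENNReal.ofReal_ne_top (hwm.eval_piLp α) (hDwz α)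
  filter_upwards [ae_all_iff.2 hwz] with x hx
  ext α
  exact sub_eq_zero.1 (hx α)

end Solutions

/-! ### The regularised solutions as convolutions of square-integrable functions -/

section Multiplier

variable {N n : ℕ} {A : Tensor N n}

lemma memLp_fourierL2 (g : EuclideanSpace ℝ (Fin n) → EuclideanSpace ℂ (Fin N)) :
    MemLp (fourierL2 g) 2 volume := by
  unfold fourierL2
  split_ifs with hg
  · exact Lp.memLp _
  · exact MemLp.zero

lemma memLp_fourierInvL2 (g : EuclideanSpace ℝ (Fin n) → EuclideanSpace ℂ (Fin N)) :
    MemLp (fourierInvL2 g) 2 volume := by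
  unfold fourierInvL2
  split_ifs with hg
  · exact Lp.memLp _
  · exact MemLp.zero

lemma eLpNorm_fourierL2_sub {g k : EuclideanSpace ℝ (Fin n) → EuclideanSpace ℂ (Fin N)}
    (hg : MemLp g 2 volume) (hk : MemLp k 2 volume) :
    eLpNorm (fourierL2 g - fourierL2 k) 2 volume = eLpNorm (g - k) 2 volume := by
  rw [fourierL2, fourierL2, dif_pos hg, dif_pos hk, ← Lp.edist_def, ← Lp.edist_toLp_toLp _ _ hg hk]
  exact (Lp.fourierTransformₗᵢ (EuclideanSpace ℝ (Fin n))
    (EuclideanSpace ℂ (Fin N))).isometry.edist_eq _ _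

lemma eLpNorm_fourierInvL2_sub {g k : EuclideanSpace ℝ (Fin n) → EuclideanSpace ℂ (Fin N)}
    (hg : MemLp g 2 volume) (hk : MemLp k 2 volume) :
    eLpNorm (fourierInvL2 g - fourierInvL2 k) 2 volume = eLpNorm (g - k) 2 volume := by
  rw [fourierInvL2, fourierInvL2, dif_pos hg, dif_pos hk, ← Lp.edist_def,
    ← Lp.edist_toLp_toLp _ _ hg hk]
  exact (Lp.fourierTransformₗᵢ (EuclideanSpace ℝ (Fin n))
    (EuclideanSpace ℂ (Fin N))).symm.isometry.edist_eq _ _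

lemma fourierL2_schwartz (φ : 𝓢(EuclideanSpace ℝ (Fin n), EuclideanSpace ℂ (Fin N))) :
    fourierL2 φ =ᵐ[volume]
      (𝓕 φ : 𝓢(EuclideanSpace ℝ (Fin n), EuclideanSpace ℂ (Fin N))) := by
  rw [fourierL2, dif_pos (φ.memLp 2 volume)]
  have h : (φ.memLp 2 volume).toLp φ = φ.toLp 2 volume := rfl
  rw [h, SchwartzMap.toLp_fourier_eq]
  exact SchwartzMap.coeFn_toLp _ _ _

lemma fourierInvL2_schwartz (φ : 𝓢(EuclideanSpace ℝ (Fin n), EuclideanSpace ℂ (Fin N))) :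
    fourierInvL2 φ =ᵐ[volume]
      (𝓕⁻ φ : 𝓢(EuclideanSpace ℝ (Fin n), EuclideanSpace ℂ (Fin N))) := by
  rw [fourierInvL2, dif_pos (φ.memLp 2 volume)]
  have h : (φ.memLp 2 volume).toLp φ = φ.toLp 2 volume := rfl
  rw [h, SchwartzMap.toLp_fourierInv_eq]
  exact SchwartzMap.coeFn_toLp _ _ _

lemma fourierL2_congr {g k : EuclideanSpace ℝ (Fin n) → EuclideanSpace ℂ (Fin N)}
    (hg : MemLp g 2 volume) (hk : MemLp k 2 volume) (h : g =ᵐ[volume] k) :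
    fourierL2 g = fourierL2 k := by
  rw [fourierL2, fourierL2, dif_pos hg, dif_pos hk, (MemLp.toLp_eq_toLp_iff hg hk).2 h]

lemma multiplied_apply (f : EuclideanSpace ℝ (Fin n) → EuclideanSpace ℝ (Fin N))
    (z : EuclideanSpace ℝ (Fin n)) :
    A.multiplied f z = matAction ℂ (A.symbol z) (fourierInvL2 (fun x => toComplex (f x)) z) := rfl

lemma memLp_multiplied (hpos : 0 < A.ellipticityConst) (hA : A.IsRankOnePositive)
    (f : EuclideanSpace ℝ (Fin n) → EuclideanSpace ℝ (Fin N)) :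
    MemLp (A.multiplied f) 2 volume := by
  have hF := memLp_fourierInvL2 fun x => toComplex (f x)
  refine MemLp.of_eval_piLp fun α => ?_
  refine MemLp.of_le_mul (c := A.ellipticityConst⁻¹) hF ?_ (ae_of_all _ fun z => ?_)
  · simp only [multiplied_apply, matAction_apply]
    refine Finset.aestronglyMeasurable_fun_sum _ fun β _ => ?_
    exact (Complex.measurable_ofReal.comp
      (measurable_symbol A α β)).aestronglyMeasurable.mul (hF.eval_piLp β).1
  · exact (PiLp.norm_apply_le _ _).trans (norm_matAction_symbol_le hpos hA z _)

lemma eLpNorm_multiplied_sub_le (hpos : 0 < A.ellipticityConst) (hA : A.IsRankOnePositive)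
    {f g : EuclideanSpace ℝ (Fin n) → EuclideanSpace ℝ (Fin N)} (hf : MemLp f 2 volume)
    (hg : MemLp g 2 volume) :
    eLpNorm (A.multiplied f - A.multiplied g) 2 volume ≤
      ENNReal.ofReal A.ellipticityConst⁻¹ * eLpNorm (f - g) 2 volume := by
  have h : eLpNorm (f - g) 2 volume =
      eLpNorm ((fun x => toComplex (f x)) - fun x => toComplex (g x)) 2 volume := by
    refine eLpNorm_congr_norm_ae (ae_of_all _ fun x => ?_)
    rw [Pi.sub_apply, Pi.sub_apply, ← toComplexCLM_apply, ← toComplexCLM_apply, ← map_sub,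
      toComplexCLM_apply, norm_toComplex]
  rw [h, ← eLpNorm_fourierInvL2_sub (memLp_toComplex hf) (memLp_toComplex hg)]
  refine eLpNorm_le_mul_eLpNorm_of_ae_le_mul (ae_of_all _ fun z => ?_) 2
  rw [Pi.sub_apply, multiplied_apply, multiplied_apply, ← map_sub]
  exact norm_matAction_symbol_le hpos hA z _

variable {V : Type*} [NormedAddCommGroup V] [NormedSpace ℂ V]

omit [NormedSpace ℂ V] in
lemma eLpNorm_comp_sub_left {a : EuclideanSpace ℝ (Fin n) → V} (ha : AEStronglyMeasurable a volume)
    (p : ℝ≥0∞) (x : EuclideanSpace ℝ (Fin n)) :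
    eLpNorm (fun t => a (x - t)) p volume = eLpNorm a p volume :=
  eLpNorm_comp_measurePreserving ha (Measure.measurePreserving_sub_left volume x)

/-- By Hölder's inequality, the convolution of two square-integrable functions exists everywhere. -/
lemma convolutionExists_of_memLp {a : EuclideanSpace ℝ (Fin n) → ℂ}
    {b : EuclideanSpace ℝ (Fin n) → V} (ha : MemLp a 2 volume) (hb : MemLp b 2 volume) :
    ConvolutionExists a b (ContinuousLinearMap.lsmul ℂ ℂ) volume := fun x => by
  have hb' : MemLp (fun t => b (x - t)) 2 volume :=
    hb.comp_measurePreserving (Measure.measurePreserving_sub_left volume x)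
  exact memLp_one_iff_integrable.1 (hb'.smul ha (p := 2) (q := 2) (r := 1))

lemma enorm_convolution_sub_le {a : EuclideanSpace ℝ (Fin n) → ℂ}
    {b c : EuclideanSpace ℝ (Fin n) → V} (ha : MemLp a 2 volume) (hb : MemLp b 2 volume)
    (hc : MemLp c 2 volume) (x : EuclideanSpace ℝ (Fin n)) :
    ‖convolution a b (ContinuousLinearMap.lsmul ℂ ℂ) volume x -
        convolution a c (ContinuousLinearMap.lsmul ℂ ℂ) volume x‖ₑ ≤
      eLpNorm a 2 volume * eLpNorm (b - c) 2 volume := by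
  have h1 := (convolutionExists_of_memLp ha hb x).integrable
  have h2 := (convolutionExists_of_memLp ha hc x).integrable
  rw [convolution, convolution, ← integral_sub h1 h2]
  refine (enorm_integral_le_lintegral_enorm _).trans ?_
  rw [← eLpNorm_one_eq_lintegral_enorm, ← eLpNorm_comp_sub_left (hb.sub hc).1 2 x]
  have hm : AEStronglyMeasurable (fun t => (b - c) (x - t)) volume :=
    ((hb.sub hc).comp_measurePreserving (Measure.measurePreserving_sub_left volume x)).1
  refine le_trans (le_of_eq ?_) (eLpNorm_smul_le_mul_eLpNorm (p := 2) (q := 2) (r := 1) hm ha.1)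
  congr 1
  ext t
  simp [smul_sub]

/-- A real-valued Schwartz function, seen as a complex-valued one. -/
def schwartzOfReal (h : 𝓢(EuclideanSpace ℝ (Fin n), ℝ)) : 𝓢(EuclideanSpace ℝ (Fin n), ℂ) :=
  h.postcompCLM Complex.ofRealCLM

lemma schwartzOfReal_apply (h : 𝓢(EuclideanSpace ℝ (Fin n), ℝ)) (x : EuclideanSpace ℝ (Fin n)) :
    schwartzOfReal h x = h x := rfl

lemma fourierSchwartz_eq (h : 𝓢(EuclideanSpace ℝ (Fin n), ℝ)) :
    fourierSchwartz h = (𝓕 (schwartzOfReal h) : 𝓢(EuclideanSpace ℝ (Fin n), ℂ)) := rfl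

lemma memLp_fourierSchwartz (h : 𝓢(EuclideanSpace ℝ (Fin n), ℝ)) :
    MemLp (fourierSchwartz h) 2 volume := by
  rw [fourierSchwartz_eq]
  exact SchwartzMap.memLp _ _ _

lemma fourier_fourier_neg [CompleteSpace V] (φ : 𝓢(EuclideanSpace ℝ (Fin n), V))
    (z : EuclideanSpace ℝ (Fin n)) : (𝓕 (𝓕 φ) : 𝓢(EuclideanSpace ℝ (Fin n), V)) (-z) = φ z := by
  rw [SchwartzMap.fourier_coe, ← Real.fourierInv_eq_fourier_neg, ← SchwartzMap.fourierInv_coe,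
    FourierTransform.fourierInv_fourier_eq]

lemma convolution_fourier_fourier [CompleteSpace V] (a : 𝓢(EuclideanSpace ℝ (Fin n), ℂ))
    (b : 𝓢(EuclideanSpace ℝ (Fin n), V)) (x : EuclideanSpace ℝ (Fin n)) :
    convolution (𝓕 a : 𝓢(EuclideanSpace ℝ (Fin n), ℂ)) (𝓕 b : 𝓢(EuclideanSpace ℝ (Fin n), V))
        (ContinuousLinearMap.lsmul ℂ ℂ) volume x =
      (𝓕 (SchwartzMap.pairing (ContinuousLinearMap.lsmul ℂ ℂ) a b) :
        𝓢(EuclideanSpace ℝ (Fin n), V)) x := by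
  rw [← SchwartzMap.convolution_apply]
  have h1 : SchwartzMap.convolution (ContinuousLinearMap.lsmul ℂ ℂ) (𝓕 a) (𝓕 b) =
      𝓕⁻ (SchwartzMap.pairing (ContinuousLinearMap.lsmul ℂ ℂ) (𝓕 (𝓕 a)) (𝓕 (𝓕 b)) :
        𝓢(EuclideanSpace ℝ (Fin n), V)) := rfl
  rw [h1, SchwartzMap.fourierInv_coe, Real.fourierInv_eq_fourier_comp_neg, SchwartzMap.fourier_coe]
  refine congrArg (fun g : EuclideanSpace ℝ (Fin n) → V => 𝓕 g x) (funext fun z => ?_)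
  simp [SchwartzMap.pairing_apply_apply, fourier_fourier_neg]

end Multiplier

/-! ### The representation formula -/

section Representation

variable {N n : ℕ} {A : Tensor N n}

/-- For `f = A : D²Φ` the bracket in the representation formula is the Fourier transform of
`-4π²|z|² Φ^∨`, so that the regularised solution is the Fourier transform of `h |z|² Φ^∨`. -/
lemma exists_approx_op_eq (hpos : 0 < A.ellipticityConst) (hA : A.IsRankOnePositive)
    (h : 𝓢(EuclideanSpace ℝ (Fin n), ℝ))
    (Φ : 𝓢(EuclideanSpace ℝ (Fin n), EuclideanSpace ℝ (Fin N))) :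
    ∃ Q : 𝓢(EuclideanSpace ℝ (Fin n), EuclideanSpace ℂ (Fin N)),
      (∀ z, Q z = (h z * ‖z‖ ^ 2) • 𝓕⁻ (complexify Φ) z) ∧
      A.approx (A.op Φ) h =
        (𝓕 Q : 𝓢(EuclideanSpace ℝ (Fin n), EuclideanSpace ℂ (Fin N))) := by
  set ψ : 𝓢(EuclideanSpace ℝ (Fin n), EuclideanSpace ℂ (Fin N)) := 𝓕⁻ (complexify Φ) with hψ
  set k : 𝓢(EuclideanSpace ℝ (Fin n), EuclideanSpace ℂ (Fin N)) :=
    (-(4 * Real.pi ^ 2) : ℝ) •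
      SchwartzMap.smulLeftCLM (EuclideanSpace ℂ (Fin N))
        (fun z : EuclideanSpace ℝ (Fin n) => ‖z‖ ^ 2) ψ with hk
  have hkz : ∀ z, k z = (-(4 * Real.pi ^ 2) * ‖z‖ ^ 2 : ℝ) • ψ z := fun z => by
    rw [hk, smul_apply, SchwartzMap.smulLeftCLM_apply_apply (by fun_prop), smul_smul]
  have hmul : A.multiplied (A.op Φ) =ᵐ[volume] k := by
    have h1 := fourierInvL2_schwartz (A.op (complexify Φ))
    have h2 : (fun x => toComplex (A.op Φ x)) = A.op (complexify Φ) := by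
      rw [op_complexify]
      rfl
    filter_upwards [h1] with z hz
    rw [multiplied_apply, h2, hz, fourierInv_op, ← Complex.coe_smul, map_smul, ← matAction_mul,
      symbol_mul_acoustic hpos hA, matAction_smul, matAction_one, hkz, Complex.coe_smul,
      mul_smul]
    congr 1
  refine ⟨(-(1 / (4 * (Real.pi : ℂ) ^ 2))) •
    SchwartzMap.pairing (ContinuousLinearMap.lsmul ℂ ℂ) (schwartzOfReal h) k, fun z => ?_, ?_⟩
  · rw [smul_apply, SchwartzMap.pairing_apply_apply, ContinuousLinearMap.lsmul_apply,
      schwartzOfReal_apply, hkz, ← Complex.coe_smul, ← Complex.coe_smul, smul_smul, smul_smul]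
    congr 1
    push_cast
    field_simp
  · funext x
    have h1 : fourierL2 (A.multiplied (A.op Φ)) =ᵐ[volume]
        (𝓕 k : 𝓢(EuclideanSpace ℝ (Fin n), EuclideanSpace ℂ (Fin N))) := by
      rw [fourierL2_congr (memLp_multiplied hpos hA _) (k.memLp 2 volume) hmul]
      exact fourierL2_schwartz k
    rw [Tensor.approx, convolution_congr _ EventuallyEq.rfl h1]
    rw [fourierSchwartz_eq, convolution_fourier_fourier, FourierTransform.fourier_smul, smul_apply]

lemma enorm_approx_sub_le (hpos : 0 < A.ellipticityConst) (hA : A.IsRankOnePositive)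
    {f g : EuclideanSpace ℝ (Fin n) → EuclideanSpace ℝ (Fin N)} (hf : MemLp f 2 volume)
    (hg : MemLp g 2 volume) (h : 𝓢(EuclideanSpace ℝ (Fin n), ℝ)) (x : EuclideanSpace ℝ (Fin n)) :
    ‖A.approx f h x - A.approx g h x‖ₑ ≤
      ‖-(1 / (4 * (Real.pi : ℂ) ^ 2))‖ₑ * (eLpNorm (fourierSchwartz h) 2 volume *
        (ENNReal.ofReal A.ellipticityConst⁻¹ * eLpNorm (f - g) 2 volume)) := by
  rw [Tensor.approx, Tensor.approx, ← smul_sub, enorm_smul]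
  gcongr
  refine (enorm_convolution_sub_le (memLp_fourierSchwartz h) (memLp_fourierL2 _)
    (memLp_fourierL2 _) x).trans ?_
  rw [eLpNorm_fourierL2_sub (memLp_multiplied hpos hA f) (memLp_multiplied hpos hA g)]
  gcongr
  exact eLpNorm_multiplied_sub_le hpos hA hf hg

/-- The regularised solutions are bounded in `L^{2**}`, uniformly in the regularisation. -/
lemma exists_eLpNorm_approx_op_le (hn : 5 ≤ n) (hpos : 0 < A.ellipticityConst)
    (hA : A.IsRankOnePositive) :
    ∃ C : ℝ≥0, ∀ (h : 𝓢(EuclideanSpace ℝ (Fin n), ℝ)),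
      (∀ᵐ x, 0 ≤ h x ∧ h x ≤ 1 / ‖x‖ ^ 2) →
      ∀ Φ : 𝓢(EuclideanSpace ℝ (Fin n), EuclideanSpace ℝ (Fin N)),
        eLpNorm (A.approx (A.op Φ) h) (expStarStar n) volume ≤
          C * eLpNorm (A.op Φ) 2 volume := by
  obtain ⟨C, hC⟩ := exists_eLpNorm_fourier_le hn N
  refine ⟨C * (1 / A.ellipticityConst).toNNReal, fun h hh Φ => ?_⟩
  obtain ⟨Q, hQ, hQa⟩ := exists_approx_op_eq hpos hA h Φ
  have hΦ : eLpNorm (A.op (complexify Φ)) 2 volume = eLpNorm (A.op Φ) 2 volume := by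
    rw [op_complexify]
    exact eLpNorm_congr_norm_ae (ae_of_all _ fun x => norm_toComplex _)
  rw [hQa, ENNReal.coe_mul, mul_assoc, ← hΦ]
  refine (hC Q).trans ?_
  gcongr
  refine le_trans ?_ (eLpNorm_hess_le_complex hpos hA (complexify Φ))
  rw [← eLpNorm_fourierInv (hess (complexify Φ))]
  refine eLpNorm_mono_ae ?_
  filter_upwards [hh] with z hz
  rw [norm_fourierInv_hess, hQ, norm_smul, Real.norm_of_nonneg (r := h z * ‖z‖ ^ 2)
    (mul_nonneg hz.1 (by positivity)), Real.norm_of_nonneg (mul_nonneg (by positivity)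
      (mul_nonneg (mul_nonneg hz.1 (by positivity)) (norm_nonneg _)))]
  have h1 : h z * ‖z‖ ^ 2 ≤ 1 := by
    calc h z * ‖z‖ ^ 2 ≤ 1 / ‖z‖ ^ 2 * ‖z‖ ^ 2 := by
          gcongr
          exact hz.2
      _ ≤ 1 := by
          rw [one_div]
          exact inv_mul_le_one
  -- `‖(D²Φ)^∨‖ = 4π² |z|² |Φ^∨|`, and the factor `4π² ≥ 1` is not needed
  have h2 : (1 : ℝ) ≤ 4 * Real.pi ^ 2 := by nlinarith [Real.pi_gt_three]
  calc ‖z‖ ^ 2 * (h z * ‖z‖ ^ 2 * ‖𝓕⁻ (complexify Φ) z‖)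
      ≤ ‖z‖ ^ 2 * (1 * ‖𝓕⁻ (complexify Φ) z‖) := by gcongr
    _ = 1 * (‖z‖ ^ 2 * ‖𝓕⁻ (complexify Φ) z‖) := by ring
    _ ≤ _ := by gcongr

/-- Dominated convergence in `L^p`. -/
lemma tendsto_eLpNorm_of_dominated {α : Type*} [MeasurableSpace α] {μ : Measure α} {p : ℝ≥0∞}
    (hp0 : p ≠ 0) (hp : p ≠ ⊤) {F : ℕ → α → ℝ} {G : α → ℝ}
    (hF : ∀ m, AEStronglyMeasurable (F m) μ) (hG : MemLp G p μ)
    (hle : ∀ m, ∀ᵐ x ∂μ, ‖F m x‖ ≤ ‖G x‖)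
    (hlim : ∀ᵐ x ∂μ, Tendsto (fun m => F m x) atTop (𝓝 0)) :
    Tendsto (fun m => eLpNorm (F m) p μ) atTop (𝓝 0) := by
  have hp' : 0 < p.toReal := ENNReal.toReal_pos hp0 hp
  simp only [eLpNorm_eq_lintegral_rpow_enorm_toReal hp0 hp]
  have h1 : Tendsto (fun m => ∫⁻ x, ‖F m x‖ₑ ^ p.toReal ∂μ) atTop (𝓝 (∫⁻ _, 0 ∂μ)) := by
    refine tendsto_lintegral_of_dominated_convergence' (fun x => ‖G x‖ₑ ^ p.toReal)
      (fun m => (hF m).enorm.pow_const _) (fun m => ?_) ?_ ?_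
    · filter_upwards [hle m] with x hx
      gcongr
      exact enorm_le_iff_norm_le.2 hx
    · exact (lintegral_rpow_enorm_lt_top_of_eLpNorm_lt_top hp0 hp hG.2).ne
    · filter_upwards [hlim] with x hx
      have h2 : Tendsto (fun m => ‖F m x‖ₑ) atTop (𝓝 0) := by simpa using hx.enorm
      simpa [ENNReal.zero_rpow_of_pos hp'] using h2.ennrpow_const p.toReal
  rw [lintegral_zero] at h1
  simpa [ENNReal.zero_rpow_of_pos (inv_pos.2 hp')] using h1.ennrpow_const (1 / p.toReal)

lemma tendsto_eLpNorm_approx_op_sub (hn : 5 ≤ n) (hpos : 0 < A.ellipticityConst)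
    (hA : A.IsRankOnePositive) {h : ℕ → 𝓢(EuclideanSpace ℝ (Fin n), ℝ)}
    (hh : IsRegularisation h) (Φ : 𝓢(EuclideanSpace ℝ (Fin n), EuclideanSpace ℝ (Fin N))) :
    Tendsto (fun m => eLpNorm (A.approx (A.op Φ) (h m) - fun x => toComplex (Φ x))
      (expStarStar n) volume) atTop (𝓝 0) := by
  obtain ⟨C, hC⟩ := exists_eLpNorm_fourier_le hn N
  choose Q hQ hQa using fun m => exists_approx_op_eq hpos hA (h m) Φ
  set ψ : 𝓢(EuclideanSpace ℝ (Fin n), EuclideanSpace ℂ (Fin N)) := 𝓕⁻ (complexify Φ) with hψ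
  have h1 : ∀ m, A.approx (A.op Φ) (h m) - (fun x => toComplex (Φ x)) =
      (𝓕 (Q m - ψ) : 𝓢(EuclideanSpace ℝ (Fin n), EuclideanSpace ℂ (Fin N))) := fun m => by
    have h2 : 𝓕 (Q m - ψ) = 𝓕 (Q m) - complexify Φ := by
      have h3 : 𝓕 ψ = complexify Φ := FourierTransform.fourier_fourierInv_eq _
      rw [← h3]
      exact map_sub (FourierTransform.fourierCLM ℂ 𝓢(EuclideanSpace ℝ (Fin n),
        EuclideanSpace ℂ (Fin N))) _ _
    rw [h2, hQa]
    rfl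
  simp only [h1]
  have hG : MemLp (fun z => ‖z‖ ^ 2 * ‖ψ z‖) 2 volume := by
    set k : 𝓢(EuclideanSpace ℝ (Fin n), EuclideanSpace ℂ (Fin N)) :=
      SchwartzMap.smulLeftCLM (EuclideanSpace ℂ (Fin N))
        (fun z : EuclideanSpace ℝ (Fin n) => ‖z‖ ^ 2) ψ with hk
    refine (k.memLp 2 volume).norm.congr_norm (by fun_prop) (ae_of_all _ fun z => ?_)
    rw [hk, SchwartzMap.smulLeftCLM_apply_apply (by fun_prop)]
    simp [norm_smul]
  have h3 : Tendsto (fun m => eLpNorm (fun z => ‖z‖ ^ 2 * ‖(Q m - ψ) z‖) 2 volume)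
      atTop (𝓝 0) := by
    have hz : ∀ᵐ z : EuclideanSpace ℝ (Fin n), z ≠ 0 := by
      have : Nonempty (Fin n) := ⟨⟨0, by omega⟩⟩
      simp [ae_iff]
    have hQψ : ∀ m z, (Q m - ψ) z = (h m z * ‖z‖ ^ 2 - 1) • ψ z := fun m z => by
      rw [sub_apply, hQ, sub_smul, one_smul]
    refine tendsto_eLpNorm_of_dominated (by simp) (by simp)
      (fun m => by fun_prop) hG (fun m => ?_) ?_
    · filter_upwards [hz, hh.bounds m] with z hz hb
      have hz2 : 0 < ‖z‖ ^ 2 := by positivity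
      have h4 : h m z * ‖z‖ ^ 2 ≤ 1 := by
        rw [← le_div_iff₀ hz2]
        exact hb.2
      have h5 : 0 ≤ h m z * ‖z‖ ^ 2 := mul_nonneg hb.1 hz2.le
      have h6 : ‖h m z * ‖z‖ ^ 2 - 1‖ ≤ 1 := by
        rw [Real.norm_eq_abs, abs_le]
        constructor <;> linarith
      rw [hQψ, norm_smul, norm_mul, norm_mul, norm_mul, norm_norm, norm_norm]
      gcongr
      exact mul_le_of_le_one_left (norm_nonneg _) h6
    · filter_upwards [hz, hh.tendsto] with z hz hl
      have hz2 : ‖z‖ ^ 2 ≠ 0 := by positivity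
      have h4 : Tendsto (fun m => h m z * ‖z‖ ^ 2 - 1) atTop (𝓝 0) := by
        have h5 := (hl.mul_const (‖z‖ ^ 2)).sub_const 1
        rwa [one_div_mul_cancel hz2, sub_self] at h5
      simp only [hQψ, norm_smul]
      simpa using (h4.norm.mul_const ‖ψ z‖).const_mul (‖z‖ ^ 2)
  refine tendsto_of_tendsto_of_tendsto_of_le_of_le tendsto_const_nhds ?_ (fun _ => zero_le)
    fun m => hC _
  simpa using ENNReal.Tendsto.const_mul (a := (C : ℝ≥0∞)) h3 (Or.inr ENNReal.coe_ne_top)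

lemma approx_op_sub (hpos : 0 < A.ellipticityConst) (hA : A.IsRankOnePositive)
    (h : 𝓢(EuclideanSpace ℝ (Fin n), ℝ))
    (Φ Ψ : 𝓢(EuclideanSpace ℝ (Fin n), EuclideanSpace ℝ (Fin N))) :
    A.approx (A.op (Φ - Ψ)) h = A.approx (A.op Φ) h - A.approx (A.op Ψ) h := by
  obtain ⟨Q, hQ, hQa⟩ := exists_approx_op_eq hpos hA h (Φ - Ψ)
  obtain ⟨Q₁, hQ₁, hQa₁⟩ := exists_approx_op_eq hpos hA h Φ
  obtain ⟨Q₂, hQ₂, hQa₂⟩ := exists_approx_op_eq hpos hA h Ψ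
  have h1 : (𝓕⁻ (complexify (Φ - Ψ)) : 𝓢(EuclideanSpace ℝ (Fin n), EuclideanSpace ℂ (Fin N))) =
      𝓕⁻ (complexify Φ) - 𝓕⁻ (complexify Ψ) := by
    rw [complexify_sub]
    exact map_sub (FourierTransform.fourierInvCLM ℂ 𝓢(EuclideanSpace ℝ (Fin n),
      EuclideanSpace ℂ (Fin N))) _ _
  have h2 : Q = Q₁ - Q₂ := by
    ext1 z
    rw [sub_apply, hQ, hQ₁, hQ₂, h1, sub_apply, smul_sub]
  have h3 : 𝓕 Q = (𝓕 Q₁ - 𝓕 Q₂ : 𝓢(EuclideanSpace ℝ (Fin n), EuclideanSpace ℂ (Fin N))) := by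
    rw [h2]
    exact map_sub (FourierTransform.fourierCLM ℂ 𝓢(EuclideanSpace ℝ (Fin n),
      EuclideanSpace ℂ (Fin N))) _ _
  rw [hQa, hQa₁, hQa₂, h3]
  rfl

lemma continuous_approx_op (hpos : 0 < A.ellipticityConst)
    (hA : A.IsRankOnePositive) (h : 𝓢(EuclideanSpace ℝ (Fin n), ℝ))
    (Φ : 𝓢(EuclideanSpace ℝ (Fin n), EuclideanSpace ℝ (Fin N))) :
    Continuous (A.approx (A.op Φ) h) := by
  obtain ⟨Q, -, hQa⟩ := exists_approx_op_eq hpos hA h Φ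
  rw [hQa]
  exact SchwartzMap.continuous _

lemma tendsto_approx_op (hpos : 0 < A.ellipticityConst) (hA : A.IsRankOnePositive)
    (h : 𝓢(EuclideanSpace ℝ (Fin n), ℝ))
    {f : EuclideanSpace ℝ (Fin n) → EuclideanSpace ℝ (Fin N)} (hf : MemLp f 2 volume)
    {Φ : ℕ → 𝓢(EuclideanSpace ℝ (Fin n), EuclideanSpace ℝ (Fin N))}
    (hΦ : Tendsto (fun k => eLpNorm (⇑(A.op (Φ k)) - f) 2 volume) atTop (𝓝 0))
    (x : EuclideanSpace ℝ (Fin n)) :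
    Tendsto (fun k => A.approx (A.op (Φ k)) h x) atTop (𝓝 (A.approx f h x)) := by
  rw [tendsto_iff_edist_tendsto_0]
  simp only [edist_eq_enorm_sub]
  refine tendsto_of_tendsto_of_tendsto_of_le_of_le tendsto_const_nhds ?_ (fun _ => zero_le)
    fun k => enorm_approx_sub_le hpos hA ((A.op (Φ k)).memLp 2 volume) hf h x
  have h1 := ENNReal.Tendsto.const_mul hΦ
    (Or.inr (ENNReal.ofReal_ne_top (r := A.ellipticityConst⁻¹)))
  have h2 := ENNReal.Tendsto.const_mul h1 (Or.inr (memLp_fourierSchwartz h).2.ne)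
  have h3 := ENNReal.Tendsto.const_mul h2
    (Or.inr (enorm_ne_top (x := -(1 / (4 * (Real.pi : ℂ) ^ 2)))))
  simpa only [mul_zero] using h3

/-- The uniform bound extends to all `f ∈ L²` by Fatou's lemma, since the regularised solutions
converge pointwise along a sequence that approximates `f`. -/
lemma eLpNorm_approx_op_sub_le (hpos : 0 < A.ellipticityConst)
    (hA : A.IsRankOnePositive) {C : ℝ≥0} {h : 𝓢(EuclideanSpace ℝ (Fin n), ℝ)}
    (hC : ∀ Φ : 𝓢(EuclideanSpace ℝ (Fin n), EuclideanSpace ℝ (Fin N)),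
      eLpNorm (A.approx (A.op Φ) h) (expStarStar n) volume ≤ C * eLpNorm (A.op Φ) 2 volume)
    {f : EuclideanSpace ℝ (Fin n) → EuclideanSpace ℝ (Fin N)} (hf : MemLp f 2 volume)
    {Φ : ℕ → 𝓢(EuclideanSpace ℝ (Fin n), EuclideanSpace ℝ (Fin N))}
    (hΦ : Tendsto (fun k => eLpNorm (⇑(A.op (Φ k)) - f) 2 volume) atTop (𝓝 0)) (k : ℕ) :
    eLpNorm (A.approx (A.op (Φ k)) h - A.approx f h) (expStarStar n) volume ≤
      C * eLpNorm (⇑(A.op (Φ k)) - f) 2 volume := by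
  have hop : ∀ k, MemLp (A.op (Φ k)) 2 volume := fun k => (A.op (Φ k)).memLp 2 volume
  have h1 : Tendsto (fun l => eLpNorm (⇑(A.op (Φ k)) - ⇑(A.op (Φ l))) 2 volume) atTop
      (𝓝 (eLpNorm (⇑(A.op (Φ k)) - f) 2 volume)) := by
    refine tendsto_eLpNorm_of_tendsto_eLpNorm_sub one_le_two (fun l => (hop k).sub (hop l))
      ((hop k).sub hf) (hΦ.congr fun l => ?_)
    rw [sub_sub_sub_cancel_left, eLpNorm_sub_comm]
  refine (Lp.eLpNorm_lim_le_liminf_eLpNorm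
    (f := fun l => A.approx (A.op (Φ k)) h - A.approx (A.op (Φ l)) h)
    (fun l => ((continuous_approx_op hpos hA h _).sub
      (continuous_approx_op hpos hA h _)).aestronglyMeasurable) _
    (ae_of_all _ fun x => (tendsto_approx_op hpos hA h hf hΦ x).const_sub _)).trans ?_
  refine (liminf_le_liminf (Eventually.of_forall fun l => ?_)).trans
    (ENNReal.Tendsto.const_mul h1 (Or.inr (ENNReal.coe_ne_top (r := C)))).liminf_eq.le
  have h2 := hC (Φ k - Φ l)
  rw [approx_op_sub hpos hA, op_sub] at h2
  exact h2

/-- The regularised solutions converge to the solution, even strongly, in `L^{2**}`. -/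
lemma tendsto_eLpNorm_approx_sub (hn : 5 ≤ n) (hpos : 0 < A.ellipticityConst)
    (hA : A.IsRankOnePositive) {h : ℕ → 𝓢(EuclideanSpace ℝ (Fin n), ℝ)}
    (hh : IsRegularisation h)
    {f : EuclideanSpace ℝ (Fin n) → EuclideanSpace ℝ (Fin N)} (hf : MemLp f 2 volume)
    {Φ : ℕ → 𝓢(EuclideanSpace ℝ (Fin n), EuclideanSpace ℝ (Fin N))}
    (hΦ : Tendsto (fun k => eLpNorm (⇑(A.op (Φ k)) - f) 2 volume) atTop (𝓝 0))
    {u : EuclideanSpace ℝ (Fin n) → EuclideanSpace ℝ (Fin N)} (hu : MemLp u (expStarStar n) volume)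
    (hul : Tendsto (fun k => eLpNorm (⇑(Φ k) - u) (expStarStar n) volume) atTop (𝓝 0)) :
    (∀ m, MemLp (A.approx f (h m)) (expStarStar n) volume) ∧
      Tendsto (fun m => eLpNorm (A.approx f (h m) - fun x => toComplex (u x))
        (expStarStar n) volume) atTop (𝓝 0) := by
  have hp := one_le_expStarStar hn
  obtain ⟨C, hC⟩ := exists_eLpNorm_approx_op_le hn hpos hA
  have hb : ∀ m k, eLpNorm (A.approx (A.op (Φ k)) (h m) - A.approx f (h m)) (expStarStar n) volume ≤
      C * eLpNorm (⇑(A.op (Φ k)) - f) 2 volume := fun m k =>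
    eLpNorm_approx_op_sub_le hpos hA (hC (h m) (hh.bounds m)) hf hΦ k
  have hm : ∀ m, AEStronglyMeasurable (A.approx f (h m)) volume := fun m =>
    aestronglyMeasurable_of_tendsto_ae atTop
      (fun k => (continuous_approx_op hpos hA (h m) (Φ k)).aestronglyMeasurable)
      (ae_of_all _ fun x => tendsto_approx_op hpos hA (h m) hf hΦ x)
  have hmk : ∀ m k, AEStronglyMeasurable (A.approx (A.op (Φ k)) (h m)) volume := fun m k =>
    (continuous_approx_op hpos hA (h m) (Φ k)).aestronglyMeasurable
  have hum := memLp_toComplex hu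
  have hΦm : ∀ k, MemLp (fun x => toComplex (Φ k x)) (expStarStar n) volume := fun k =>
    memLp_toComplex ((Φ k).memLp _ volume)
  have hlim : Tendsto (fun m => eLpNorm (A.approx f (h m) - fun x => toComplex (u x))
      (expStarStar n) volume) atTop (𝓝 0) := by
    have hsum : Tendsto (fun k => (C : ℝ≥0∞) * eLpNorm (⇑(A.op (Φ k)) - f) 2 volume +
        eLpNorm (⇑(Φ k) - u) (expStarStar n) volume) atTop (𝓝 0) := by
      simpa using (ENNReal.Tendsto.const_mul hΦ (Or.inr (ENNReal.coe_ne_top (r := C)))).add hul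
    rw [ENNReal.tendsto_nhds_zero] at hsum ⊢
    intro ε hε
    -- `k` is chosen independently of `m`, since the bound `hb` is uniform in `m`
    obtain ⟨k, hk⟩ := (hsum (ε / 2) (ENNReal.half_pos hε.ne')).exists
    filter_upwards [ENNReal.tendsto_nhds_zero.1 (tendsto_eLpNorm_approx_op_sub hn hpos hA hh (Φ k))
      (ε / 2) (ENNReal.half_pos hε.ne')] with m hmε
    have e1 : A.approx f (h m) - (fun x => toComplex (u x)) =
        -(A.approx (A.op (Φ k)) (h m) - A.approx f (h m)) +
          ((fun x => toComplex (Φ k x)) - fun x => toComplex (u x)) +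
          (A.approx (A.op (Φ k)) (h m) - fun x => toComplex (Φ k x)) := by abel
    have e2 : eLpNorm ((fun x => toComplex (Φ k x)) - fun x => toComplex (u x)) (expStarStar n)
        volume = eLpNorm (⇑(Φ k) - u) (expStarStar n) volume := by
      refine eLpNorm_congr_norm_ae (ae_of_all _ fun x => ?_)
      rw [Pi.sub_apply, Pi.sub_apply, ← toComplexCLM_apply, ← toComplexCLM_apply, ← map_sub,
        toComplexCLM_apply, norm_toComplex]
    have m1 := (hmk m k).sub (hm m)
    have m2 := (hΦm k).1.sub hum.1
    have m3 := (hmk m k).sub (hΦm k).1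
    calc _ ≤ eLpNorm (-(A.approx (A.op (Φ k)) (h m) - A.approx f (h m))) (expStarStar n) volume +
          eLpNorm ((fun x => toComplex (Φ k x)) - fun x => toComplex (u x)) (expStarStar n) volume +
          eLpNorm (A.approx (A.op (Φ k)) (h m) - fun x => toComplex (Φ k x)) (expStarStar n)
            volume := by
          rw [e1]
          exact (eLpNorm_add_le (m1.neg.add m2) m3 hp).trans
            (add_le_add_left (eLpNorm_add_le m1.neg m2 hp) _)
      _ ≤ C * eLpNorm (⇑(A.op (Φ k)) - f) 2 volume +
          eLpNorm (⇑(Φ k) - u) (expStarStar n) volume + ε / 2 := by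
          rw [eLpNorm_neg, e2]
          gcongr
          exact hb m k
      _ ≤ ε / 2 + ε / 2 := by gcongr
      _ = ε := ENNReal.add_halves ε
  refine ⟨fun m => ⟨hm m, ?_⟩, hlim⟩
  obtain ⟨Q, -, hQa⟩ := exists_approx_op_eq hpos hA (h m) (Φ 0)
  have h0 : MemLp (A.approx (A.op (Φ 0)) (h m)) (expStarStar n) volume := by
    rw [hQa]
    exact SchwartzMap.memLp _ _ _
  have h1 : MemLp (A.approx (A.op (Φ 0)) (h m) - A.approx f (h m)) (expStarStar n) volume :=
    ⟨h0.1.sub (hm m), (hb m 0).trans_lt (ENNReal.mul_lt_top ENNReal.coe_lt_top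
      (((A.op (Φ 0)).memLp 2 volume).sub hf).2)⟩
  simpa using (h0.sub h1).2

end Representation

end LinSys

end

theorem theorem1 (n N : ℕ) (hn : 5 ≤ n) (hN : 2 ≤ N) (A : LinSys.Tensor N n)
    (hA : A.IsSymm) (hApos : A.IsRankOnePositive) :
    ∃ C : ℝ, 0 < C ∧
      ∀ f : EuclideanSpace ℝ (Fin n) → EuclideanSpace ℝ (Fin N), MemLp f 2 volume →
        ∃ (u : EuclideanSpace ℝ (Fin n) → EuclideanSpace ℝ (Fin N))
          (Du : EuclideanSpace ℝ (Fin n) → EuclideanSpace ℝ (Fin N × Fin n))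
          (D2u : EuclideanSpace ℝ (Fin n) → EuclideanSpace ℝ (Fin N × Fin n × Fin n)),
          -- `u` is a strong solution in the energy space
          LinSys.IsW22Star u Du D2u ∧
          (∀ᵐ x, A.contract (D2u x) = f x) ∧
          -- it is the only one
          (∀ (v : EuclideanSpace ℝ (Fin n) → EuclideanSpace ℝ (Fin N))
            (Dv : EuclideanSpace ℝ (Fin n) → EuclideanSpace ℝ (Fin N × Fin n))
            (D2v : EuclideanSpace ℝ (Fin n) → EuclideanSpace ℝ (Fin N × Fin n × Fin n)),
            LinSys.IsW22Star v Dv D2v → (∀ᵐ x, A.contract (D2v x) = f x) → v =ᵐ[volume] u) ∧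
          -- the two estimates
          eLpNorm u (LinSys.expStarStar n) volume + eLpNorm Du (LinSys.expStar n) volume +
            eLpNorm D2u 2 volume ≤ ENNReal.ofReal C * eLpNorm f 2 volume ∧
          eLpNorm D2u 2 volume ≤ ENNReal.ofReal (1 / A.ellipticityConst) *
            eLpNorm (fun x => A.contract (D2u x)) 2 volume ∧
          -- the representation formula, whose ingredients are well defined
          MemLp (A.multiplied f) 2 volume ∧
          (∀ h : ℕ → 𝓢(EuclideanSpace ℝ (Fin n), ℝ), LinSys.IsRegularisation h →
            (∀ m, ConvolutionExists (LinSys.fourierSchwartz (h m))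
              (LinSys.fourierL2 (A.multiplied f)) (ContinuousLinearMap.lsmul ℂ ℂ) volume) ∧
            LinSys.WeakLpTendsto (LinSys.expStarStar n) (fun m => A.approx f (h m))
              (fun x => LinSys.toComplex (u x)) ∧
            (∀ ψ : ℕ → ℕ, StrictMono ψ → ∃ φ : ℕ → ℕ, StrictMono φ ∧
              ∀ᵐ x, Tendsto (fun k => A.approx f (h (ψ (φ k))) x) atTop
                (𝓝 (LinSys.toComplex (u x))))) := by
  open LinSys in
  have hpos : 0 < A.ellipticityConst := ellipticityConst_pos (by omega) (by omega) hApos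
  obtain ⟨C, hC⟩ := exists_apriori hn hpos hApos
  -- each of the three norms is at most `C ‖f‖`; the summand `1` makes the constant positive
  refine ⟨3 * C + 1, by positivity, fun f hf => ?_⟩
  obtain ⟨Φ, hΦ⟩ := exists_seq_op_tendsto (by omega) hpos hApos hf
  obtain ⟨u, Du, D2u, hu, huf, hul, h0, h1, h2, h3⟩ := exists_solution hn hpos hApos hC hf hΦ
  refine ⟨u, Du, D2u, hu, huf, fun v Dv D2v hv hvf => ?_, ?_, ?_, memLp_multiplied hpos hApos f,
    fun h hh => ?_⟩
  · refine solution_unique hn hpos hApos hA hu hv ?_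
    filter_upwards [huf, hvf] with x hx hx'
    rw [hx, hx']
  · calc _ ≤ C * eLpNorm f 2 volume + C * eLpNorm f 2 volume + C * eLpNorm f 2 volume := by gcongr
      _ = ENNReal.ofReal (3 * C) * eLpNorm f 2 volume := by
          rw [ENNReal.ofReal_mul (by norm_num), ENNReal.ofReal_coe_nnreal, ENNReal.ofReal_ofNat]
          ring
      _ ≤ _ := by
          gcongr
          linarith
  · rwa [eLpNorm_congr_ae huf]
  · obtain ⟨hm, hlim⟩ := tendsto_eLpNorm_approx_sub hn hpos hApos hh hf hΦ hu.memLp hul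
    have hum := memLp_toComplex hu.memLp
    refine ⟨fun m => convolutionExists_of_memLp (memLp_fourierSchwartz _) (memLp_fourierL2 _),
      ⟨hm, hum, fun q hq g hg => ?_⟩, fun ψ hψ => ?_⟩
    · exact tendsto_integral_of_tendsto_eLpNorm hq hm hum hg hlim (fun v w => inner ℂ w v)
        (fun c hc => hg.1.inner hc.1) (fun v w => (norm_inner_le_norm w v).trans_eq (mul_comm _ _))
        fun v v' w => inner_sub_right _ _ _
    · refine (tendstoInMeasure_of_tendsto_eLpNorm (one_pos.trans_le (one_le_expStarStar hn)).ne'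
        (fun m => (hm (ψ m)).1) hum.1 (hlim.comp hψ.tendsto_atTop)).exists_seq_tendsto_ae
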